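/- **Setting.** Let $n\ge 2$, $\delta\in(0,1]$, $\sigma\ge 0$ and $\theta=(\theta_1,\dots,\theta_n)\in\mathbb R^n$. Observations are $y_t=\theta_t+Z_t$, $t=1,\dots,n$, where $Z_1,\dots,Z_n$ are independent and $\sigma$-subgaussian, i.e. $\mathbb E\,e^{\lambda Z_t}\le e^{\lambda^2\sigma^2/2}$ for all $\lambda\in\mathbb R$ (in particular they have mean zero). In round $t$ a forecaster predicts $x_t$ from $y_1,\dots,y_{t-1}$ only. Write $D\theta=(\theta_2-\theta_1,\dots,\theta_n-\theta_{n-1})$ and $\bar y_{a:t}=\frac1{t-a+1}\sum_{s=a}^t y_s$. **The ARROWS policy** with inputs $n$, $\sigma$, $\beta$. Put $y_0=0$ and start a new bin at $t_h=1$. For $t=1,\dots,n$: if a new bin starts in round $t$ (i.e. $t_h=t$), predict $x_t=y_{t-1}$, otherwise predict $x_t=\bar y_{t_h:t-1}$. Then observe $y_t$. Let $\tilde y\in\mathbb R^k$ be the vector $(y_{t_h}-\bar y_{t_h:t},\dots,y_t-\bar y_{t_h:t})$, padded with zeros at the end up to the least power of two $k\ge t-t_h+1$. Let $H$ be the orthogonal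 $k\times k$ discrete Haar wavelet transform matrix, and let $\hat\alpha$ be the result of soft-thresholding $H\tilde y$ entrywise at level $\sigma\sqrt{\beta\log n}$. For $0\le l<\log_2 k$ let $\hat\alpha[l]$ be the block of the $2^l$ entries of $\hat\alpha$ that belong to the Haar wavelets of level $l$. If $$\frac1{\sqrt k}\sum_{l=0}^{\log_2 k-1}2^{l/2}\,\|\hat\alpha[l]\|_1>\frac{\sigma}{\sqrt k},$$ a new bin starts in round $t+1$, i.e. $t_h$ is set to $t+1$. The policy uses neither $\theta$ nor any bound on $\|D\theta\|_1$. **Theorem.** There are universal constants $C>0$ and $k_0\in\mathbb N$ such that for all $n,\delta,\sigma,\theta$ and all noise variables as above, the ARROWS policy with $\beta=24+\frac{8\log(8/\delta)}{\log n}$ satisfies, with probability at least $1-\delta$, $$\sum_{t=1}^n (x_t-\theta_t)^2\;\le\; C\,\bigl(1+\log n+\log(1/\delta)\bigr)^{k_0}\Bigl(n^{1/3}\|D\theta\|_1^{2/3}\sigma^{4/3}+|\theta_1|^2+\|D\theta\|_2^2+\sigma^2\Bigr).$$ -/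

import Mathlib

open MeasureTheory ProbabilityTheory
open scoped NNReal Matrix

noncomputable section

namespace Arrows

/-- A forecasting strategy: before round `i + 1` the player has seen the `i` observations
`y_1, …, y_i` and plays a real number that is a function of these only. -/
def Strategy : Type := (i : ℕ) → (Fin i → ℝ) → ℝ

/-- The cumulative squared error `∑ (x_t - θ_t)²` of a strategy on the truth `θ` when the
observations are `y`. Rounds are indexed by `Fin n`, so that `θ_1` is `θ 0`. -/
def cumulativeError {n : ℕ} (A : Strategy) (θ y : Fin n → ℝ) : ℝ :=
  ∑ t : Fin n, (A t (fun s : Fin t => y ⟨s, s.isLt.trans t.isLt⟩) - θ t) ^ 2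

/-- The discrete difference operator `Dθ = (θ_2 - θ_1, …, θ_n - θ_{n-1})`. -/
def diff {n : ℕ} (θ : Fin n → ℝ) (i : Fin (n - 1)) : ℝ :=
  θ ⟨i + 1, by omega⟩ - θ ⟨i, by omega⟩

/-- Soft thresholding at level `lam`. -/
def softThreshold (lam x : ℝ) : ℝ := Real.sign x * max (|x| - lam) 0

/-- The orthogonal discrete Haar wavelet transform matrix of size `2 ^ m`. Row `0` is constant.
Row `2 ^ l + i` with `l < m`, `i < 2 ^ l` is the `i`-th Haar wavelet of level `l`: it is supported
on the dyadic block `[i * w, (i + 1) * w)` of width `w = 2 ^ (m - l)`, is `-1 / √w` on the first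
half of the block and `1 / √w` on the second half. -/
def haarMatrix (m : ℕ) : Matrix (Fin (2 ^ m)) (Fin (2 ^ m)) ℝ :=
  Matrix.of fun j s =>
    if j.val = 0 then 1 / √((2 : ℝ) ^ m)
    else
      let l := Nat.log 2 j.val
      let i := j.val - 2 ^ l
      let w := 2 ^ (m - l)
      if i * w ≤ s.val ∧ s.val < i * w + w / 2 then -(1 / √(w : ℝ))
      else if i * w + w / 2 ≤ s.val ∧ s.val < (i + 1) * w then 1 / √(w : ℝ)
      else 0

/-- The `ℓ¹` norm of the block `α[l]` of level-`l` coefficients: it consists of the `2 ^ l`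
entries of `α` at the positions `2 ^ l, …, 2 ^ (l + 1) - 1`, counted from `0`. -/
def blockNorm {m : ℕ} (α : Fin (2 ^ m) → ℝ) (l : ℕ) : ℝ :=
  ∑ j : Fin (2 ^ m) with 2 ^ l ≤ j.val ∧ j.val < 2 ^ (l + 1), |α j|

/-- The average of `y_a, …, y_t`. -/
def mean (y : ℕ → ℝ) (a t : ℕ) : ℝ := (∑ s ∈ Finset.Icc a t, y s) / ((t + 1 - a : ℕ) : ℝ)

/-- The padded length of the segment `y_a, …, y_t` is `2 ^ padExp a t`, the least power of two
that is at least the length of the segment. -/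
def padExp (a t : ℕ) : ℕ := Nat.clog 2 (t + 1 - a)

/-- The recentred segment `y_a, …, y_t`, padded with zeros at the end. -/
def pad (y : ℕ → ℝ) (a t : ℕ) (j : Fin (2 ^ padExp a t)) : ℝ :=
  if a + j.val ≤ t then y (a + j.val) - mean y a t else 0

/-- The soft-thresholded Haar coefficients of the segment `y_a, …, y_t`. -/
def thresholdedCoeffs (lam : ℝ) (y : ℕ → ℝ) (a t : ℕ) (j : Fin (2 ^ padExp a t)) : ℝ :=
  softThreshold lam ((haarMatrix (padExp a t) *ᵥ pad y a t) j)

/-- The restart rule, evaluated on the current bin `y_a, …, y_t`. -/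
def Restart (σ lam : ℝ) (y : ℕ → ℝ) (a t : ℕ) : Prop :=
  σ / √((2 : ℝ) ^ padExp a t) <
    1 / √((2 : ℝ) ^ padExp a t) *
      ∑ l ∈ Finset.range (padExp a t),
        (2 : ℝ) ^ ((l : ℝ) / 2) * blockNorm (thresholdedCoeffs lam y a t) l

open Classical in
/-- The value of the start time `t_h` of the current bin after round `t` has been processed.
Rounds are counted from `1`; a new bin is to be opened in round `t + 1` if and only if this value
is `t + 1`. -/
def binStart (σ lam : ℝ) (y : ℕ → ℝ) : ℕ → ℕ
  | 0 => 1
  | t + 1 =>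
    if Restart σ lam y (binStart σ lam y t) (t + 1) then t + 2 else binStart σ lam y t

/-- The prediction for round `t + 1`, from `y_1, …, y_t` (with the convention `y_0 = 0`): the last
observation if a new bin opens, and else the average of the observations in the current bin. -/
def predict (σ lam : ℝ) (y : ℕ → ℝ) (t : ℕ) : ℝ :=
  if binStart σ lam y t = t + 1 then y t else mean y (binStart σ lam y t) t

/-- Past observations `y_1, …, y_i` as a sequence on `ℕ` with `y_0 = 0`. -/
def extendZero {i : ℕ} (past : Fin i → ℝ) (s : ℕ) : ℝ :=
  if h : 1 ≤ s ∧ s ≤ i then past ⟨s - 1, by omega⟩ else 0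

/-- The ARROWS policy with time horizon `n`, noise parameter `σ` and hyper-parameter `β`; its
threshold is `σ √(β log n)`. -/
def policy (n : ℕ) (σ β : ℝ) : Strategy := fun i past =>
  predict σ (σ * √(β * Real.log n)) (extendZero past) i

end Arrows

end

/-! Write `lam` for the threshold σ√(β log n). The bins depend on the data, so the noise is
controlled on all segments `[a, t]` at once. A Haar coefficient of a recentred segment and a
normalized segment sum are linear functionals of norm at most one, hence σ-subgaussian. There are at
most 2n³ of them, and β is chosen so that all stay below `lam / 2` outside an event of probability
at most δ (`exists_measureReal_le_noiseBound`). The rest is deterministic.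

A segment of length L with variation V has rate (lam⁴ L V²)^(1/3). Two facts tie it to the test. A
restart forces some coefficient of θ up to `lam / 2`; coefficients are bounded by a multiple of √L
V, so lam² is at most twice the rate (`sq_le_rate_of_restart`). Without a restart every coefficient
of θ is at most `3 * lam`; interpolating this sup bound with the ℓ¹ bound by V makes the energy of
each level at most six times the rate, and Parseval bounds the scatter of θ
(`scatter_le_of_not_restart`).

Predicting by running means costs a multiple of the scatter, one last jump, and a harmonic sum of
noise, about lam² log n per bin (`binError_le`). A closed bin pays its lam² out of its own rate, and
by Hölder the rates of consecutive bins add up to at most the rate of the whole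
(`rate_add_rate_le`). Hence the number of bins never enters, and only the last, unpaid bin leaves a
lam² term. -/

noncomputable section

namespace Arrows

/-! ### Haar coefficients: Parseval and total variation -/

/-- The entries of `haarMatrix`, indexed by natural numbers. -/
def haarEntry (m j s : ℕ) : ℝ :=
  if j = 0 then 1 / √((2 : ℝ) ^ m)
  else
    let l := Nat.log 2 j
    let i := j - 2 ^ l
    let w := 2 ^ (m - l)
    if i * w ≤ s ∧ s < i * w + w / 2 then -(1 / √(w : ℝ))
    else if i * w + w / 2 ≤ s ∧ s < (i + 1) * w then 1 / √(w : ℝ)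
    else 0

/-- The Haar coefficients of the first `2 ^ m` terms of a sequence. -/
def haarCoeff (m : ℕ) (g : ℕ → ℝ) (j : ℕ) : ℝ :=
  ∑ s ∈ Finset.range (2 ^ m), haarEntry m j s * g s

theorem haarMatrix_mulVec (m : ℕ) (g : ℕ → ℝ) (j : Fin (2 ^ m)) :
    (haarMatrix m *ᵥ fun s => g s) j = haarCoeff m g j := by
  unfold haarCoeff
  rw [← Fin.sum_univ_eq_sum_range (fun s => haarEntry m j s * g s)]
  rfl

theorem haarCoeff_eq (l r i : ℕ) (hi : i < 2 ^ l) (g : ℕ → ℝ) :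
    haarCoeff (l + r + 1) g (2 ^ l + i) =
      1 / √((2 : ℝ) ^ (r + 1)) *
        (∑ u ∈ Finset.range (2 ^ r), g (i * 2 ^ (r + 1) + 2 ^ r + u) -
          ∑ u ∈ Finset.range (2 ^ r), g (i * 2 ^ (r + 1) + u)) := by
  have hlog : Nat.log 2 (2 ^ l + i) = l := by
    apply Nat.log_eq_of_pow_le_of_lt_pow
    · omega
    · rw [pow_succ]; omega
  have hpos : 0 < 2 ^ l := by positivity
  have hw : 2 ^ (l + r + 1 - l) = 2 * 2 ^ r := by
    rw [show l + r + 1 - l = r + 1 by omega, pow_succ]; ring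
  have hw' : (2 : ℕ) ^ (r + 1) = 2 * 2 ^ r := by rw [pow_succ]; ring
  have hle : i * (2 * 2 ^ r) + 2 * 2 ^ r ≤ 2 ^ (l + r + 1) := by
    have : (i + 1) * (2 * 2 ^ r) ≤ 2 ^ l * (2 * 2 ^ r) := Nat.mul_le_mul_right _ hi
    calc _ = (i + 1) * (2 * 2 ^ r) := by ring
      _ ≤ _ := this
      _ = _ := by ring
  set h := 2 ^ r with hh
  have key : ∀ s, haarEntry (l + r + 1) (2 ^ l + i) s * g s =
      1 / √((2 : ℝ) ^ (r + 1)) *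
        ((if s ∈ Finset.Ico (i * (2 * h) + h) (i * (2 * h) + 2 * h) then g s else 0) -
          (if s ∈ Finset.Ico (i * (2 * h)) (i * (2 * h) + h) then g s else 0)) := by
    intro s
    have h0 : 2 ^ l + i ≠ 0 := by omega
    have hhpos : 0 < h := by positivity
    have hcast : ((2 * h : ℕ) : ℝ) = 2 ^ (r + 1) := by rw [← hw']; push_cast; rfl
    unfold haarEntry
    simp only [h0, if_false, hlog, hw, Nat.add_sub_cancel_left, Finset.mem_Ico, hcast,
      Nat.mul_div_cancel_left h two_pos, add_mul, one_mul]
    by_cases h1 : i * (2 * h) ≤ s ∧ s < i * (2 * h) + h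
    · have h2 : ¬ (i * (2 * h) + h ≤ s ∧ s < i * (2 * h) + 2 * h) := by omega
      simp [h1, h2]
    · by_cases h2 : i * (2 * h) + h ≤ s ∧ s < i * (2 * h) + 2 * h
      · rw [if_neg h1, if_pos h2, if_pos h2, if_neg h1, sub_zero]
      · rw [if_neg h1, if_neg h2, if_neg h2, if_neg h1]; simp
  unfold haarCoeff
  rw [Finset.sum_congr rfl fun s _ => key s, ← Finset.mul_sum, Finset.sum_sub_distrib,
    Finset.sum_ite_mem, Finset.sum_ite_mem]
  have e1 : Finset.range (2 ^ (l + r + 1)) ∩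
      Finset.Ico (i * (2 * h) + h) (i * (2 * h) + 2 * h) =
      Finset.Ico (i * (2 * h) + h) (i * (2 * h) + 2 * h) := by
    ext s; simp only [Finset.mem_inter, Finset.mem_range, Finset.mem_Ico]; omega
  have e2 : Finset.range (2 ^ (l + r + 1)) ∩
      Finset.Ico (i * (2 * h)) (i * (2 * h) + h) =
      Finset.Ico (i * (2 * h)) (i * (2 * h) + h) := by
    ext s; simp only [Finset.mem_inter, Finset.mem_range, Finset.mem_Ico]; omega
  rw [e1, e2, Finset.sum_Ico_eq_sum_range, Finset.sum_Ico_eq_sum_range, hw',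
    show i * (2 * h) + 2 * h - (i * (2 * h) + h) = h by omega,
    show i * (2 * h) + h - i * (2 * h) = h by omega]

theorem sum_range_two_mul (f : ℕ → ℝ) (N : ℕ) :
    ∑ i ∈ Finset.range (2 * N), f i = ∑ i ∈ Finset.range N, (f (2 * i) + f (2 * i + 1)) := by
  induction N with
  | zero => simp
  | succ N ih =>
    rw [show 2 * (N + 1) = 2 * N + 1 + 1 by ring, Finset.sum_range_succ, Finset.sum_range_succ,
      ih, Finset.sum_range_succ]
    ring

theorem sum_range_mul_block (f : ℕ → ℝ) (N W : ℕ) :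
    ∑ i ∈ Finset.range N, ∑ u ∈ Finset.range W, f (i * W + u) =
      ∑ s ∈ Finset.range (N * W), f s := by
  induction N with
  | zero => simp
  | succ N ih => rw [Finset.sum_range_succ, ih, Nat.succ_mul, Finset.sum_range_add]

/-- The energy of the projection of `g` to the functions that are constant on the blocks of
width `W`. -/
def blockEnergy (N W : ℕ) (g : ℕ → ℝ) : ℝ :=
  ∑ i ∈ Finset.range N, (∑ u ∈ Finset.range W, g (i * W + u)) ^ 2 / (W : ℝ)

/-- Halving a block with half-sums A and B is the identity A² + B² = ((A + B)² + (B - A)²) / 2: the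
first square is the coarse block, the second its Haar coefficient. -/
theorem blockEnergy_succ (l r : ℕ) (g : ℕ → ℝ) :
    blockEnergy (2 ^ (l + 1)) (2 ^ r) g = blockEnergy (2 ^ l) (2 ^ (r + 1)) g +
      ∑ i ∈ Finset.range (2 ^ l), haarCoeff (l + r + 1) g (2 ^ l + i) ^ 2 := by
  unfold blockEnergy
  rw [show 2 ^ (l + 1) = 2 * 2 ^ l by ring, sum_range_two_mul, ← Finset.sum_add_distrib]
  refine Finset.sum_congr rfl fun i hi => ?_
  rw [haarCoeff_eq l r i (Finset.mem_range.mp hi) g]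
  have hsplit : ∑ u ∈ Finset.range (2 ^ (r + 1)), g (i * 2 ^ (r + 1) + u) =
      ∑ u ∈ Finset.range (2 ^ r), g (i * 2 ^ (r + 1) + u) +
      ∑ u ∈ Finset.range (2 ^ r), g (i * 2 ^ (r + 1) + 2 ^ r + u) := by
    rw [show 2 ^ (r + 1) = 2 ^ r + 2 ^ r by ring, Finset.sum_range_add]
    simp [add_assoc]
  rw [hsplit, show 2 * i * 2 ^ r = i * 2 ^ (r + 1) by ring,
    show (2 * i + 1) * 2 ^ r = i * 2 ^ (r + 1) + 2 ^ r by ring]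
  set A := ∑ u ∈ Finset.range (2 ^ r), g (i * 2 ^ (r + 1) + u)
  set B := ∑ u ∈ Finset.range (2 ^ r), g (i * 2 ^ (r + 1) + 2 ^ r + u)
  have hs : √((2 : ℝ) ^ (r + 1)) ^ 2 = 2 ^ (r + 1) := Real.sq_sqrt (by positivity)
  rw [mul_pow, div_pow, hs]
  push_cast
  have : (0 : ℝ) < 2 ^ r := by positivity
  rw [pow_succ]
  field_simp
  ring

/-- Parseval's identity for sequences with sum zero. -/
theorem sum_haarCoeff_sq (m : ℕ) (g : ℕ → ℝ) (hg : ∑ s ∈ Finset.range (2 ^ m), g s = 0) :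
    ∑ l ∈ Finset.range m, ∑ i ∈ Finset.range (2 ^ l), haarCoeff m g (2 ^ l + i) ^ 2 =
      ∑ s ∈ Finset.range (2 ^ m), g s ^ 2 := by
  -- The block energies telescope from one block, whose energy vanishes because the sum of `g` is
  -- zero, to blocks of width one.
  have h : ∀ l ≤ m, blockEnergy (2 ^ l) (2 ^ (m - l)) g =
      ∑ l ∈ Finset.range l, ∑ i ∈ Finset.range (2 ^ l), haarCoeff m g (2 ^ l + i) ^ 2 := by
    intro l
    induction l with
    | zero => intro _; simp [blockEnergy, hg]
    | succ l ih =>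
      intro hl
      obtain ⟨r, rfl⟩ : ∃ r, m = l + r + 1 := ⟨m - l - 1, by omega⟩
      have := ih (by omega)
      rw [Finset.sum_range_succ, ← this, show l + r + 1 - (l + 1) = r by omega,
        show l + r + 1 - l = r + 1 by omega, blockEnergy_succ]
  rw [← h m le_rfl]
  simp [blockEnergy]

theorem abs_sub_le_sum_abs (g : ℕ → ℝ) {a b : ℕ} (hab : a ≤ b) :
    |g b - g a| ≤ ∑ u ∈ Finset.Ico a b, |g (u + 1) - g u| := by
  rw [← Finset.sum_Ico_sub g hab]
  exact Finset.abs_sum_le_sum_abs _ _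

/-- Points of the two halves are paired at distance half a width, and each of the `2 ^ r`
differences is at most the variation on the block. The step leaving the block is included, so that
the blocks of a level tile the whole range. -/
theorem abs_haarCoeff_le (l r i : ℕ) (hi : i < 2 ^ l) (g : ℕ → ℝ) :
    |haarCoeff (l + r + 1) g (2 ^ l + i)| ≤ √((2 : ℝ) ^ (r + 1)) / 2 *
      ∑ u ∈ Finset.range (2 ^ (r + 1)),
        |g (i * 2 ^ (r + 1) + u + 1) - g (i * 2 ^ (r + 1) + u)| := by
  rw [haarCoeff_eq l r i hi, ← Finset.sum_sub_distrib, abs_mul]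
  set T := ∑ u ∈ Finset.range (2 ^ (r + 1)),
        |g (i * 2 ^ (r + 1) + u + 1) - g (i * 2 ^ (r + 1) + u)| with hT
  have hw : (2 : ℕ) ^ (r + 1) = 2 * 2 ^ r := by rw [pow_succ]; ring
  have h1 : ∀ u ∈ Finset.range (2 ^ r),
      |g (i * 2 ^ (r + 1) + 2 ^ r + u) - g (i * 2 ^ (r + 1) + u)| ≤ T := by
    intro u hu
    rw [Finset.mem_range] at hu
    refine (abs_sub_le_sum_abs g (by omega)).trans ?_
    have hT' : T = ∑ u ∈ Finset.Ico (i * 2 ^ (r + 1)) (i * 2 ^ (r + 1) + 2 ^ (r + 1)),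
        |g (u + 1) - g u| := by
      rw [Finset.sum_Ico_eq_sum_range, Nat.add_sub_cancel_left]
    rw [hT']
    refine Finset.sum_le_sum_of_subset_of_nonneg ?_ fun _ _ _ => abs_nonneg _
    exact Finset.Ico_subset_Ico (by omega) (by omega)
  have h2 := (Finset.abs_sum_le_sum_abs
    (fun u => g (i * 2 ^ (r + 1) + 2 ^ r + u) - g (i * 2 ^ (r + 1) + u))
    (Finset.range (2 ^ r))).trans (Finset.sum_le_card_nsmul _ _ _ h1)
  rw [Finset.card_range, nsmul_eq_mul] at h2
  have hsp : 0 < √((2 : ℝ) ^ (r + 1)) := by positivity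
  have hs : √((2 : ℝ) ^ (r + 1)) ^ 2 = 2 ^ (r + 1) := Real.sq_sqrt (by positivity)
  rw [abs_of_pos (by positivity : 0 < 1 / √((2 : ℝ) ^ (r + 1)))]
  refine (mul_le_mul_of_nonneg_left h2 (by positivity)).trans (le_of_eq ?_)
  push_cast
  have : (2 : ℝ) ^ r = √((2 : ℝ) ^ (r + 1)) ^ 2 / 2 := by rw [hs, pow_succ]; ring
  rw [this]
  field_simp

/-- The level-`l` Haar coefficients are controlled by the total variation. -/
theorem sum_abs_haarCoeff_le (m l : ℕ) (hl : l < m) (g : ℕ → ℝ) :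
    ∑ i ∈ Finset.range (2 ^ l), |haarCoeff m g (2 ^ l + i)| ≤ √((2 : ℝ) ^ (m - l)) / 2 *
      ∑ u ∈ Finset.range (2 ^ m), |g (u + 1) - g u| := by
  obtain ⟨r, rfl⟩ : ∃ r, m = l + r + 1 := ⟨m - l - 1, by omega⟩
  refine (Finset.sum_le_sum fun i hi =>
    abs_haarCoeff_le l r i (Finset.mem_range.mp hi) g).trans (le_of_eq ?_)
  rw [← Finset.mul_sum, sum_range_mul_block (fun u => |g (u + 1) - g u|),
    show l + r + 1 - l = r + 1 by omega, ← pow_add, add_assoc]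

/-! ### Recentred segments and the restart statistic -/

/-- The recentred and padded segment `y_a, …, y_t` as a sequence on `ℕ`. -/
def padSeq (y : ℕ → ℝ) (a t u : ℕ) : ℝ :=
  if a + u ≤ t then y (a + u) - mean y a t else 0

/-- The Haar coefficients of the recentred and padded segment. -/
def segCoeff (y : ℕ → ℝ) (a t j : ℕ) : ℝ := haarCoeff (padExp a t) (padSeq y a t) j

/-- The total variation of `θ` on the segment `[a, t]`. -/
def variation (θ : ℕ → ℝ) (a t : ℕ) : ℝ := ∑ u ∈ Finset.Ico a t, |θ (u + 1) - θ u|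

/-- The sum of squared deviations from the mean on the segment `[a, t]`. -/
def scatter (θ : ℕ → ℝ) (a t : ℕ) : ℝ := ∑ s ∈ Finset.Icc a t, (θ s - mean θ a t) ^ 2

/-- The minimax rate `lam ^ (4/3) * L ^ (1/3) * V ^ (2/3)` of a segment of length `L` on which
`θ` has total variation `V`. -/
def rate (lam : ℝ) (θ : ℕ → ℝ) (a t : ℕ) : ℝ :=
  (lam ^ 4 * ((t + 1 - a : ℕ) : ℝ) * variation θ a t ^ 2) ^ (1 / 3 : ℝ)

theorem variation_nonneg (θ : ℕ → ℝ) (a t : ℕ) : 0 ≤ variation θ a t :=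
  Finset.sum_nonneg fun _ _ => abs_nonneg _

theorem rate_nonneg (lam : ℝ) (θ : ℕ → ℝ) (a t : ℕ) : 0 ≤ rate lam θ a t := by
  unfold rate; positivity

/-- Rates are compared through their cubes, which contain no fractional powers. -/
theorem rate_pow_three (lam : ℝ) (θ : ℕ → ℝ) (a t : ℕ) :
    rate lam θ a t ^ 3 = lam ^ 4 * ((t + 1 - a : ℕ) : ℝ) * variation θ a t ^ 2 := by
  unfold rate
  rw [← Real.rpow_natCast, ← Real.rpow_mul (by positivity)]
  norm_num

theorem abs_softThreshold {lam : ℝ} (hlam : 0 ≤ lam) (x : ℝ) :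
    |softThreshold lam x| = max (|x| - lam) 0 := by
  unfold softThreshold
  rcases lt_trichotomy x 0 with h | h | h
  · rw [Real.sign_of_neg h, abs_mul, abs_of_nonneg (le_max_right (|x| - lam) 0)]; simp
  · subst h; simp [hlam]
  · rw [Real.sign_of_pos h, abs_mul, abs_of_nonneg (le_max_right (|x| - lam) 0)]; simp

theorem thresholdedCoeffs_apply (lam : ℝ) (y : ℕ → ℝ) (a t : ℕ) (j : Fin (2 ^ padExp a t)) :
    thresholdedCoeffs lam y a t j = softThreshold lam (segCoeff y a t j) := by
  unfold thresholdedCoeffs segCoeff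
  rw [← haarMatrix_mulVec]
  rfl

theorem blockNorm_thresholdedCoeffs (lam : ℝ) (y : ℕ → ℝ) (a t l : ℕ) (hl : l < padExp a t) :
    blockNorm (thresholdedCoeffs lam y a t) l =
      ∑ i ∈ Finset.range (2 ^ l), |softThreshold lam (segCoeff y a t (2 ^ l + i))| := by
  unfold blockNorm
  simp only [thresholdedCoeffs_apply]
  rw [Finset.sum_filter, Fin.sum_univ_eq_sum_range (fun j => if 2 ^ l ≤ j ∧ j < 2 ^ (l + 1) then
    |softThreshold lam (segCoeff y a t j)| else 0), ← Finset.sum_filter]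
  have hle : 2 ^ (l + 1) ≤ 2 ^ padExp a t := Nat.pow_le_pow_right two_pos hl
  have : (Finset.range (2 ^ padExp a t)).filter (fun j => 2 ^ l ≤ j ∧ j < 2 ^ (l + 1)) =
      Finset.Ico (2 ^ l) (2 ^ (l + 1)) := by
    ext j; simp only [Finset.mem_filter, Finset.mem_range, Finset.mem_Ico]; omega
  rw [this, Finset.sum_Ico_eq_sum_range, show 2 ^ (l + 1) - 2 ^ l = 2 ^ l by rw [pow_succ]; omega]

theorem exists_lt_abs_of_restart {σ lam : ℝ} (hσ : 0 ≤ σ) (hlam : 0 ≤ lam) {y : ℕ → ℝ} {a t : ℕ}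
    (h : Restart σ lam y a t) :
    ∃ l < padExp a t, ∃ i < 2 ^ l, lam < |segCoeff y a t (2 ^ l + i)| := by
  by_contra! hcon
  unfold Restart at h
  rw [Finset.sum_eq_zero, mul_zero] at h
  · exact absurd h (not_lt.mpr (by positivity))
  · intro l hl
    rw [Finset.mem_range] at hl
    rw [blockNorm_thresholdedCoeffs _ _ _ _ _ hl, Finset.sum_eq_zero, mul_zero]
    intro i hi
    rw [abs_softThreshold hlam, max_eq_right]
    linarith [hcon l hl i (Finset.mem_range.mp hi)]

/-- The weights `2 ^ (l / 2)` are at least one, so a silent test bounds each thresholded coefficient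
by `σ`; thresholding removes at most `lam`. -/
theorem abs_segCoeff_le_of_not_restart {σ lam : ℝ} (hlam : 0 ≤ lam) {y : ℕ → ℝ} {a t : ℕ}
    (h : ¬ Restart σ lam y a t) {l i : ℕ} (hl : l < padExp a t) (hi : i < 2 ^ l) :
    |segCoeff y a t (2 ^ l + i)| ≤ σ + lam := by
  unfold Restart at h
  rw [not_lt, one_div_mul_eq_div, div_le_div_iff_of_pos_right (by positivity)] at h
  have hnn : ∀ l, 0 ≤ blockNorm (thresholdedCoeffs lam y a t) l := fun l =>
    Finset.sum_nonneg fun _ _ => abs_nonneg _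
  have h1 := (Finset.single_le_sum (f := fun l : ℕ => (2 : ℝ) ^ ((l : ℝ) / 2) *
    blockNorm (thresholdedCoeffs lam y a t) l) (fun l _ => mul_nonneg (by positivity) (hnn l))
    (Finset.mem_range.mpr hl)).trans h
  have h2 : (1 : ℝ) ≤ 2 ^ ((l : ℝ) / 2) := Real.one_le_rpow (by norm_num) (by positivity)
  have h3 : blockNorm (thresholdedCoeffs lam y a t) l ≤ σ :=
    (le_mul_of_one_le_left (hnn l) h2).trans h1
  rw [blockNorm_thresholdedCoeffs _ _ _ _ _ hl] at h3
  have h4 := (Finset.single_le_sum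
    (f := fun i => |softThreshold lam (segCoeff y a t (2 ^ l + i))|)
    (fun _ _ => abs_nonneg _) (Finset.mem_range.mpr hi)).trans h3
  simp only [abs_softThreshold hlam] at h4
  linarith [le_max_left (|segCoeff y a t (2 ^ l + i)| - lam) 0]

theorem mean_add (θ z : ℕ → ℝ) (a t : ℕ) :
    mean (fun s => θ s + z s) a t = mean θ a t + mean z a t := by
  unfold mean; rw [Finset.sum_add_distrib, add_div]

theorem padSeq_add (θ z : ℕ → ℝ) (a t u : ℕ) :
    padSeq (fun s => θ s + z s) a t u = padSeq θ a t u + padSeq z a t u := by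
  unfold padSeq; rw [mean_add]; split_ifs <;> ring

theorem segCoeff_add (θ z : ℕ → ℝ) (a t j : ℕ) :
    segCoeff (fun s => θ s + z s) a t j = segCoeff θ a t j + segCoeff z a t j := by
  unfold segCoeff haarCoeff
  simp only [padSeq_add, mul_add, Finset.sum_add_distrib]

theorem le_two_pow_padExp (a t : ℕ) : t + 1 - a ≤ 2 ^ padExp a t :=
  Nat.le_pow_clog one_lt_two _

theorem two_pow_padExp_le {a t : ℕ} (h : a ≤ t) : 2 ^ padExp a t ≤ 2 * (t + 1 - a) := by
  unfold padExp
  rcases Nat.lt_or_ge 1 (t + 1 - a) with h1 | h1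
  · have h2 := Nat.pow_pred_clog_lt_self one_lt_two h1
    have h3 := Nat.clog_pos one_lt_two h1
    obtain ⟨c, hc⟩ : ∃ c, Nat.clog 2 (t + 1 - a) = c + 1 := ⟨_, (Nat.succ_pred_eq_of_pos h3).symm⟩
    rw [hc] at h2 ⊢
    simp only [Nat.pred_succ] at h2
    rw [pow_succ]; omega
  · rw [Nat.clog_of_right_le_one h1, pow_zero]; omega

theorem two_pow_padExp_le_real {a t : ℕ} (h : a ≤ t) :
    (2 : ℝ) ^ padExp a t ≤ 2 * ((t + 1 - a : ℕ) : ℝ) := by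
  exact_mod_cast two_pow_padExp_le h

theorem length_mul_mean (y : ℕ → ℝ) {a t : ℕ} (h : a ≤ t) :
    ((t + 1 - a : ℕ) : ℝ) * mean y a t = ∑ s ∈ Finset.Icc a t, y s := by
  unfold mean
  have : ((t + 1 - a : ℕ) : ℝ) ≠ 0 := by norm_cast; omega
  field_simp

theorem sum_padSeq_comp (F : ℝ → ℝ) (hF : F 0 = 0) (y : ℕ → ℝ) {a t : ℕ} (h : a ≤ t) :
    ∑ u ∈ Finset.range (2 ^ padExp a t), F (padSeq y a t u) =
      ∑ s ∈ Finset.Icc a t, F (y s - mean y a t) := by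
  have h1 : ∑ u ∈ Finset.range (2 ^ padExp a t), F (padSeq y a t u) =
      ∑ u ∈ Finset.range (t + 1 - a), F (padSeq y a t u) := by
    symm
    refine Finset.sum_subset (Finset.range_subset_range.mpr (le_two_pow_padExp a t)) ?_
    intro u _ hu
    rw [Finset.mem_range] at hu
    rw [padSeq, if_neg (by omega), hF]
  rw [h1, show Finset.Icc a t = Finset.Ico a (t + 1) by ext; simp,
    Finset.sum_Ico_eq_sum_range]
  refine Finset.sum_congr rfl fun u hu => ?_
  rw [Finset.mem_range] at hu
  rw [padSeq, if_pos (by omega)]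

theorem sum_padSeq (y : ℕ → ℝ) {a t : ℕ} (h : a ≤ t) :
    ∑ u ∈ Finset.range (2 ^ padExp a t), padSeq y a t u = 0 := by
  refine (sum_padSeq_comp id rfl y h).trans ?_
  simp only [id, Finset.sum_sub_distrib, Finset.sum_const, nsmul_eq_mul, Nat.card_Icc]
  rw [length_mul_mean y h, sub_self]

theorem sum_segCoeff_sq (y : ℕ → ℝ) {a t : ℕ} (h : a ≤ t) :
    ∑ l ∈ Finset.range (padExp a t), ∑ i ∈ Finset.range (2 ^ l),
      segCoeff y a t (2 ^ l + i) ^ 2 = scatter y a t := by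
  unfold segCoeff
  rw [sum_haarCoeff_sq _ _ (sum_padSeq y h), sum_padSeq_comp (· ^ 2) (by simp) y h, scatter]

theorem variation_mono (θ : ℕ → ℝ) {a b c d : ℕ} (h1 : a ≤ b) (h2 : c ≤ d) :
    variation θ b c ≤ variation θ a d :=
  Finset.sum_le_sum_of_subset_of_nonneg (Finset.Ico_subset_Ico h1 h2) fun _ _ _ => abs_nonneg _

theorem abs_sub_mean_le (θ : ℕ → ℝ) {a t : ℕ} (h : a ≤ t) :
    |θ t - mean θ a t| ≤ variation θ a t := by
  have hL : (0 : ℝ) < ((t + 1 - a : ℕ) : ℝ) := by norm_cast; omega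
  have h1 : ((t + 1 - a : ℕ) : ℝ) * (θ t - mean θ a t) = ∑ s ∈ Finset.Icc a t, (θ t - θ s) := by
    rw [mul_sub, length_mul_mean θ h, Finset.sum_sub_distrib, Finset.sum_const, nsmul_eq_mul,
      Nat.card_Icc]
  have h2 : |∑ s ∈ Finset.Icc a t, (θ t - θ s)| ≤
      ((t + 1 - a : ℕ) : ℝ) * variation θ a t := by
    refine (Finset.abs_sum_le_sum_abs _ _).trans ?_
    refine (Finset.sum_le_card_nsmul _ _ (variation θ a t) ?_).trans (le_of_eq ?_)
    · intro s hs
      rw [Finset.mem_Icc] at hs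
      exact (abs_sub_le_sum_abs θ hs.2).trans (variation_mono θ hs.1 le_rfl)
    · rw [Nat.card_Icc, nsmul_eq_mul]
  rw [← h1, abs_mul, abs_of_pos hL] at h2
  exact le_of_mul_le_mul_left h2 hL

/-- Recentring keeps all inner steps; the only new one is the drop to the zero padding. It is the
distance from the last value to the mean, which is again at most the variation. -/
theorem sum_abs_padSeq_sub_le (θ : ℕ → ℝ) {a t : ℕ} (h : a ≤ t) :
    ∑ u ∈ Finset.range (2 ^ padExp a t), |padSeq θ a t (u + 1) - padSeq θ a t u| ≤
      2 * variation θ a t := by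
  have h1 : ∑ u ∈ Finset.range (2 ^ padExp a t), |padSeq θ a t (u + 1) - padSeq θ a t u| =
      ∑ u ∈ Finset.range (t - a + 1), |padSeq θ a t (u + 1) - padSeq θ a t u| := by
    symm
    refine Finset.sum_subset (Finset.range_subset_range.mpr ?_) ?_
    · have := le_two_pow_padExp a t; omega
    · intro u _ hu
      rw [Finset.mem_range] at hu
      rw [padSeq, if_neg (by omega), padSeq, if_neg (by omega)]; simp
  rw [h1, Finset.sum_range_succ]
  have h2 : ∑ u ∈ Finset.range (t - a), |padSeq θ a t (u + 1) - padSeq θ a t u| =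
      variation θ a t := by
    unfold variation
    rw [Finset.sum_Ico_eq_sum_range]
    refine Finset.sum_congr rfl fun u hu => ?_
    rw [Finset.mem_range] at hu
    rw [padSeq, if_pos (by omega), padSeq, if_pos (by omega), ← add_assoc]
    congr 1; ring
  have h3 : |padSeq θ a t (t - a + 1) - padSeq θ a t (t - a)| ≤ variation θ a t := by
    rw [padSeq, if_neg (by omega), padSeq, if_pos (by omega), show a + (t - a) = t by omega,
      zero_sub, abs_neg]
    exact abs_sub_mean_le θ h
  linarith

theorem sum_abs_segCoeff_le (θ : ℕ → ℝ) {a t l : ℕ} (h : a ≤ t) (hl : l < padExp a t) :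
    ∑ i ∈ Finset.range (2 ^ l), |segCoeff θ a t (2 ^ l + i)| ≤
      √((2 : ℝ) ^ (padExp a t - l)) * variation θ a t := by
  refine (sum_abs_haarCoeff_le _ l hl _).trans ?_
  have := mul_le_mul_of_nonneg_left (sum_abs_padSeq_sub_le θ h)
    (by positivity : 0 ≤ √((2 : ℝ) ^ (padExp a t - l)) / 2)
  linarith

/-! ### The two outcomes of the restart test -/

/-- Each restart is paid for by the variation of `θ` on the closed bin. -/
theorem sq_le_rate_of_restart {σ lam : ℝ} (hσ : 0 ≤ σ) (hlam : 0 ≤ lam) {θ z : ℕ → ℝ} {a t : ℕ}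
    (hat : a ≤ t)
    (hz : ∀ l < padExp a t, ∀ i < 2 ^ l, |segCoeff z a t (2 ^ l + i)| ≤ lam / 2)
    (h : Restart σ lam (fun s => θ s + z s) a t) : lam ^ 2 ≤ 2 * rate lam θ a t := by
  obtain ⟨l, hl, i, hi, hlt⟩ := exists_lt_abs_of_restart hσ hlam h
  rw [segCoeff_add] at hlt
  have h1 : lam / 2 ≤ |segCoeff θ a t (2 ^ l + i)| := by
    linarith [abs_add_le (segCoeff θ a t (2 ^ l + i)) (segCoeff z a t (2 ^ l + i)), hz l hl i hi]
  have h2 := (Finset.single_le_sum (f := fun i => |segCoeff θ a t (2 ^ l + i)|)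
    (fun _ _ => abs_nonneg _) (Finset.mem_range.mpr hi)).trans (sum_abs_segCoeff_le θ hat hl)
  have h3 := h1.trans h2
  have h4 := pow_le_pow_left₀ (by linarith) h3 2
  rw [mul_pow, Real.sq_sqrt (by positivity)] at h4
  have h5 : (2 : ℝ) ^ (padExp a t - l) ≤ 2 ^ padExp a t :=
    pow_le_pow_right₀ one_le_two (Nat.sub_le _ _)
  have h6 : lam ^ 2 ≤ 8 * (((t + 1 - a : ℕ) : ℝ) * variation θ a t ^ 2) := by
    have := mul_le_mul_of_nonneg_right (h5.trans (two_pow_padExp_le_real hat))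
      (sq_nonneg (variation θ a t))
    nlinarith
  -- Multiplying lam² ≤ 8 L V² by lam⁴ gives lam⁶ on the left and the cube of twice the rate on the
  -- right.
  refine le_of_pow_le_pow_left₀ (n := 3) (by norm_num)
    (mul_nonneg zero_le_two (rate_nonneg _ _ _ _)) ?_
  rw [mul_pow, rate_pow_three]
  have := mul_le_mul_of_nonneg_left h6 (by positivity : 0 ≤ lam ^ 4)
  nlinarith

/-- Without a restart the segment is well approximated by its mean. -/
theorem scatter_le_of_not_restart {σ lam : ℝ} (hσlam : σ ≤ lam) (hlam : 0 ≤ lam)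
    {θ z : ℕ → ℝ} {a t : ℕ} (hat : a ≤ t)
    (hz : ∀ l < padExp a t, ∀ i < 2 ^ l, |segCoeff z a t (2 ^ l + i)| ≤ lam / 2)
    (h : ¬ Restart σ lam (fun s => θ s + z s) a t) :
    scatter θ a t ≤ padExp a t * (6 * rate lam θ a t) := by
  rw [← sum_segCoeff_sq θ hat]
  refine (Finset.sum_le_card_nsmul _ _ (6 * rate lam θ a t) ?_).trans (le_of_eq ?_)
  swap
  · rw [Finset.card_range, nsmul_eq_mul]
  intro l hl
  rw [Finset.mem_range] at hl
  -- `σ + lam` from the silent test plus `lam / 2` of noise, rounded up using `σ ≤ lam`.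
  have hb : ∀ i < 2 ^ l, |segCoeff θ a t (2 ^ l + i)| ≤ 3 * lam := by
    intro i hi
    have h1 := abs_segCoeff_le_of_not_restart hlam h hl hi
    rw [segCoeff_add] at h1
    have h2 := abs_sub_abs_le_abs_sub (segCoeff θ a t (2 ^ l + i)) (-segCoeff z a t (2 ^ l + i))
    rw [abs_neg, sub_neg_eq_add] at h2
    linarith [hz l hl i hi]
  set q := ∑ i ∈ Finset.range (2 ^ l), segCoeff θ a t (2 ^ l + i) ^ 2 with hq
  set V := variation θ a t
  have hq0 : 0 ≤ q := Finset.sum_nonneg fun _ _ => sq_nonneg _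
  have hA : q ≤ 2 ^ l * (3 * lam) ^ 2 := by
    refine (Finset.sum_le_card_nsmul _ _ ((3 * lam) ^ 2) ?_).trans (le_of_eq ?_)
    · intro i hi
      rw [← sq_abs]
      exact pow_le_pow_left₀ (abs_nonneg _) (hb i (Finset.mem_range.mp hi)) 2
    · rw [Finset.card_range, nsmul_eq_mul]; push_cast; rfl
  have hB : q ≤ 3 * lam * (√((2 : ℝ) ^ (padExp a t - l)) * V) := by
    refine le_trans ?_ (mul_le_mul_of_nonneg_left (sum_abs_segCoeff_le θ hat hl)
      (by linarith))
    rw [Finset.mul_sum]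
    refine Finset.sum_le_sum fun i hi => ?_
    rw [← sq_abs, sq]
    exact mul_le_mul_of_nonneg_right (hb i (Finset.mem_range.mp hi)) (abs_nonneg _)
  refine le_of_pow_le_pow_left₀ (n := 3) (by norm_num)
    (mul_nonneg (by norm_num) (rate_nonneg _ _ _ _)) ?_
  rw [mul_pow, rate_pow_three]
  have hB2 := pow_le_pow_left₀ hq0 hB 2
  rw [mul_pow, mul_pow (√_), Real.sq_sqrt (by positivity)] at hB2
  have h2 : (2 : ℝ) ^ l * 2 ^ (padExp a t - l) = 2 ^ padExp a t := by
    rw [← pow_add]; congr 1; omega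
  -- One factor takes the sup bound and two take the ℓ¹ bound: with these weights the powers of two
  -- combine to `2 ^ padExp a t`, free of the level `l`.
  calc q ^ 3 = q * q ^ 2 := by ring
    _ ≤ (2 ^ l * (3 * lam) ^ 2) * ((3 * lam) ^ 2 * (2 ^ (padExp a t - l) * V ^ 2)) :=
        mul_le_mul hA hB2 (by positivity) (by positivity)
    _ = 81 * lam ^ 4 * V ^ 2 * (2 ^ l * 2 ^ (padExp a t - l)) := by ring
    _ = 81 * lam ^ 4 * V ^ 2 * 2 ^ padExp a t := by rw [h2]
    _ ≤ 81 * lam ^ 4 * V ^ 2 * (2 * ((t + 1 - a : ℕ) : ℝ)) :=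
        mul_le_mul_of_nonneg_left (two_pow_padExp_le_real hat) (by positivity)
    _ ≤ 6 ^ 3 * (lam ^ 4 * ((t + 1 - a : ℕ) : ℝ) * V ^ 2) := by
        have : 0 ≤ lam ^ 4 * ((t + 1 - a : ℕ) : ℝ) * V ^ 2 := by positivity
        linarith

/-! ### Superadditivity of the rate -/

/-- AM-GM for x, x, y, from (2x + y)³ - 27x²y = (x - y)²(8x + y). -/
theorem three_mul_le_of_pow_three_eq {s x y : ℝ} (hx : 0 ≤ x) (hy : 0 ≤ y)
    (h : s ^ 3 = x ^ 2 * y) : 3 * s ≤ 2 * x + y := by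
  refine le_of_pow_le_pow_left₀ (n := 3) (by norm_num) (by positivity) ?_
  have : 0 ≤ (x - y) ^ 2 * (8 * x + y) := by positivity
  rw [mul_pow, h]
  nlinarith

/-- Hölder's inequality for two summands, in terms of cubes. -/
theorem add_pow_three_le {c x₁ x₂ v₁ v₂ r₁ r₂ : ℝ} (hc : 0 ≤ c) (hx₁ : 0 ≤ x₁) (hx₂ : 0 ≤ x₂)
    (hv₁ : 0 ≤ v₁) (hv₂ : 0 ≤ v₂) (h₁ : r₁ ^ 3 = c * x₁ * v₁ ^ 2)
    (h₂ : r₂ ^ 3 = c * x₂ * v₂ ^ 2) :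
    (r₁ + r₂) ^ 3 ≤ c * (x₁ + x₂) * (v₁ + v₂) ^ 2 := by
  have e1 : 3 * (r₁ ^ 2 * r₂) ≤ 2 * (c * x₁ * v₁ * v₂) + c * x₂ * v₁ ^ 2 := by
    apply three_mul_le_of_pow_three_eq (by positivity) (by positivity)
    calc (r₁ ^ 2 * r₂) ^ 3 = (r₁ ^ 3) ^ 2 * r₂ ^ 3 := by ring
      _ = _ := by rw [h₁, h₂]; ring
  have e2 : 3 * (r₂ ^ 2 * r₁) ≤ 2 * (c * x₂ * v₂ * v₁) + c * x₁ * v₂ ^ 2 := by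
    apply three_mul_le_of_pow_three_eq (by positivity) (by positivity)
    calc (r₂ ^ 2 * r₁) ^ 3 = (r₂ ^ 3) ^ 2 * r₁ ^ 3 := by ring
      _ = _ := by rw [h₁, h₂]; ring
  calc (r₁ + r₂) ^ 3 = r₁ ^ 3 + r₂ ^ 3 + 3 * (r₁ ^ 2 * r₂) + 3 * (r₂ ^ 2 * r₁) := by ring
    _ ≤ c * x₁ * v₁ ^ 2 + c * x₂ * v₂ ^ 2 + (2 * (c * x₁ * v₁ * v₂) + c * x₂ * v₁ ^ 2) +
        (2 * (c * x₂ * v₂ * v₁) + c * x₁ * v₂ ^ 2) := by rw [h₁, h₂]; linarith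
    _ = _ := by ring

/-- Lengths add exactly, while the variations of the two pieces omit the step from `p` to `p + 1`;
Hölder with exponents 3 and 3/2 does the rest. -/
theorem rate_add_rate_le (lam : ℝ) (θ : ℕ → ℝ) {p t : ℕ} (h : p ≤ t) :
    rate lam θ 1 p + rate lam θ (p + 1) t ≤ rate lam θ 1 t := by
  refine le_of_pow_le_pow_left₀ (n := 3) (by norm_num) (rate_nonneg _ _ _ _) ?_
  refine (add_pow_three_le (by positivity : 0 ≤ lam ^ 4) (Nat.cast_nonneg _) (Nat.cast_nonneg _)
    (variation_nonneg θ 1 p) (variation_nonneg θ (p + 1) t) (rate_pow_three lam θ 1 p)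
    (rate_pow_three lam θ (p + 1) t)).trans ?_
  rw [rate_pow_three]
  have hL : ((p + 1 - 1 : ℕ) : ℝ) + ((t + 1 - (p + 1) : ℕ) : ℝ) = ((t + 1 - 1 : ℕ) : ℝ) := by
    norm_cast; omega
  have hV : variation θ 1 p + variation θ (p + 1) t ≤ variation θ 1 t := by
    unfold variation
    rw [← Finset.sum_union]
    · refine Finset.sum_le_sum_of_subset_of_nonneg ?_ fun _ _ _ => abs_nonneg _
      intro u; simp only [Finset.mem_union, Finset.mem_Ico]; omega
    · rw [Finset.disjoint_left]
      intro u; simp only [Finset.mem_Ico]; omega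
  rw [hL]
  have := add_nonneg (variation_nonneg θ 1 p) (variation_nonneg θ (p + 1) t)
  gcongr

theorem rate_mono_right (lam : ℝ) (θ : ℕ → ℝ) {a c d : ℕ} (h : c ≤ d) :
    rate lam θ a c ≤ rate lam θ a d := by
  refine le_of_pow_le_pow_left₀ (n := 3) (by norm_num) (rate_nonneg _ _ _ _) ?_
  rw [rate_pow_three, rate_pow_three]
  have hV := variation_mono θ (le_refl a) h
  have := variation_nonneg θ a c
  have hL : ((c + 1 - a : ℕ) : ℝ) ≤ ((d + 1 - a : ℕ) : ℝ) := by norm_cast; omega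
  gcongr

/-! ### Running means and scatter -/

theorem scatter_nonneg (θ : ℕ → ℝ) (a t : ℕ) : 0 ≤ scatter θ a t :=
  Finset.sum_nonneg fun _ _ => sq_nonneg _

theorem scatter_eq (θ : ℕ → ℝ) {a t : ℕ} (h : a ≤ t) :
    scatter θ a t =
      ∑ s ∈ Finset.Icc a t, θ s ^ 2 - ((t + 1 - a : ℕ) : ℝ) * mean θ a t ^ 2 := by
  unfold scatter
  have : ∀ s, (θ s - mean θ a t) ^ 2 = θ s ^ 2 - 2 * mean θ a t * θ s + mean θ a t ^ 2 :=
    fun s => by ring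
  simp only [this]
  rw [Finset.sum_add_distrib, Finset.sum_sub_distrib, ← Finset.mul_sum, ← length_mul_mean θ h,
    Finset.sum_const, nsmul_eq_mul, Nat.card_Icc]
  ring

theorem scatter_le_sum_sq (θ : ℕ → ℝ) {a t : ℕ} (h : a ≤ t) :
    scatter θ a t ≤ ∑ s ∈ Finset.Icc a t, θ s ^ 2 := by
  rw [scatter_eq θ h]
  have : 0 ≤ ((t + 1 - a : ℕ) : ℝ) * mean θ a t ^ 2 := by positivity
  linarith

/-- Welford's recursion for the scatter, as an inequality. -/
theorem sq_mean_sub_le (θ : ℕ → ℝ) {a t : ℕ} (h : a ≤ t) :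
    (mean θ a t - θ (t + 1)) ^ 2 ≤ 2 * (scatter θ a (t + 1) - scatter θ a t) := by
  have hN : (1 : ℝ) ≤ ((t + 1 - a : ℕ) : ℝ) := by norm_cast; omega
  have hN' : ((t + 1 + 1 - a : ℕ) : ℝ) = ((t + 1 - a : ℕ) : ℝ) + 1 := by norm_cast; omega
  have hm : (((t + 1 - a : ℕ) : ℝ) + 1) * mean θ a (t + 1) =
      ((t + 1 - a : ℕ) : ℝ) * mean θ a t + θ (t + 1) := by
    rw [← hN', length_mul_mean θ (by omega), length_mul_mean θ h,
      Finset.sum_Icc_succ_top (by omega)]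
  rw [scatter_eq θ h, scatter_eq θ (by omega), Finset.sum_Icc_succ_top (by omega), hN']
  set N := ((t + 1 - a : ℕ) : ℝ)
  set m := mean θ a t
  have hm' : mean θ a (t + 1) = (N * m + θ (t + 1)) / (N + 1) := by
    rw [eq_div_iff (by positivity), ← hm]; ring
  rw [hm']
  -- The scatter grows by exactly N / (N + 1) times the squared prediction error, and N ≥ 1 makes
  -- this factor at least 1/2.
  have key : 2 * (∑ s ∈ Finset.Icc a t, θ s ^ 2 + θ (t + 1) ^ 2 -
      (N + 1) * ((N * m + θ (t + 1)) / (N + 1)) ^ 2 -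
      (∑ s ∈ Finset.Icc a t, θ s ^ 2 - N * m ^ 2)) =
      2 * N / (N + 1) * (m - θ (t + 1)) ^ 2 := by
    field_simp
    ring
  rw [key]
  refine le_mul_of_one_le_left (sq_nonneg _) ?_
  rw [le_div_iff₀ (by positivity)]
  linarith

theorem sum_sq_mean_sub_le (θ : ℕ → ℝ) {a c : ℕ} (h : a ≤ c) :
    ∑ t ∈ Finset.Ico a c, (mean θ a t - θ (t + 1)) ^ 2 ≤ 2 * scatter θ a c := by
  induction c, h using Nat.le_induction with
  | base => simpa using scatter_nonneg θ a a
  | succ c hc ih =>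
    rw [Finset.sum_Ico_succ_top hc]
    linarith [sq_mean_sub_le θ hc]

theorem sq_last_sub_mean_le (θ : ℕ → ℝ) {a t : ℕ} (h : a ≤ t) :
    (θ t - mean θ a t) ^ 2 ≤ scatter θ a t :=
  Finset.single_le_sum (f := fun s => (θ s - mean θ a t) ^ 2) (fun _ _ => sq_nonneg _)
    (Finset.mem_Icc.mpr ⟨h, le_rfl⟩)

/-- The running means incur an error that is controlled by the scatter of the segment without its
last point and by the last jump. -/
theorem sum_sq_mean_sub_le' (θ : ℕ → ℝ) {a c : ℕ} (h : a ≤ c) :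
    ∑ t ∈ Finset.Ico a (c + 1), (mean θ a t - θ (t + 1)) ^ 2 ≤
      4 * scatter θ a c + 2 * (θ (c + 1) - θ c) ^ 2 := by
  rw [Finset.sum_Ico_succ_top h]
  have h1 := sum_sq_mean_sub_le θ h
  have h2 := sq_last_sub_mean_le θ h
  nlinarith [sq_nonneg ((θ c - mean θ a c) - (θ (c + 1) - θ c))]

/-! ### Deterministic analysis under the noise bounds -/

/-- The bounds on the noise on which the analysis of the policy rests. -/
structure NoiseBound (n : ℕ) (lam : ℝ) (z : ℕ → ℝ) : Prop where
  zero : z 0 = 0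
  coeff : ∀ a t, 1 ≤ a → a ≤ t → t ≤ n → ∀ l < padExp a t, ∀ i < 2 ^ l,
    |segCoeff z a t (2 ^ l + i)| ≤ lam / 2
  sum : ∀ a t, 1 ≤ a → a ≤ t → t ≤ n →
    (∑ s ∈ Finset.Icc a t, z s) ^ 2 ≤ ((t + 1 - a : ℕ) : ℝ) * (lam / 2) ^ 2

theorem padExp_le {n a t : ℕ} (ha : 1 ≤ a) (hat : a ≤ t) (htn : t ≤ n) :
    (padExp a t : ℝ) ≤ 2 * (1 + Real.log n) := by
  have hn : (1 : ℝ) ≤ n := by norm_cast; omega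
  have hlog : 0 ≤ Real.log n := Real.log_nonneg hn
  rcases Nat.eq_zero_or_pos (padExp a t) with h | h
  · rw [h, Nat.cast_zero]; positivity
  have h1 : (2 : ℝ) ^ padExp a t ≤ 2 * n := by
    refine (two_pow_padExp_le_real hat).trans ?_
    have : ((t + 1 - a : ℕ) : ℝ) ≤ n := by norm_cast; omega
    linarith
  have h2 := Real.log_le_log (by positivity) h1
  rw [Real.log_pow, Real.log_mul (by norm_num) (by positivity)] at h2
  have h3 : (1 : ℝ) ≤ padExp a t := by exact_mod_cast h
  nlinarith [Real.log_two_gt_d9]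

/-- The squared error in a bin that opens in round `p + 1` and is used up to round `b`. -/
def binError (θ y : ℕ → ℝ) (p b : ℕ) : ℝ :=
  (y p - θ (p + 1)) ^ 2 + ∑ t ∈ Finset.Ico (p + 1) b, (mean y (p + 1) t - θ (t + 1)) ^ 2

/-- The squared mean of N noise terms is at most `(lam / 2) ^ 2 / N`, so a bin costs a harmonic sum.
-/
theorem sum_sq_mean_noise_le {n : ℕ} {lam : ℝ} {z : ℕ → ℝ} (hz : NoiseBound n lam z) {p b : ℕ}
    (hpb : p < b) (hbn : b ≤ n) :
    ∑ t ∈ Finset.Ico (p + 1) b, mean z (p + 1) t ^ 2 ≤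
      (lam / 2) ^ 2 * (1 + Real.log n) := by
  have h1 : ∀ t ∈ Finset.Ico (p + 1) b,
      mean z (p + 1) t ^ 2 ≤ (lam / 2) ^ 2 * ((t - p : ℕ) : ℝ)⁻¹ := by
    intro t ht
    rw [Finset.mem_Ico] at ht
    have h := hz.sum (p + 1) t (by omega) ht.1 (by omega)
    unfold mean
    have hL : (t + 1 - (p + 1) : ℕ) = t - p := by omega
    have hpos : (0 : ℝ) < ((t - p : ℕ) : ℝ) := by norm_cast; omega
    rw [hL] at h ⊢
    rw [div_pow, div_le_iff₀ (by positivity)]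
    calc _ ≤ _ := h
      _ = _ := by field_simp
  refine (Finset.sum_le_sum h1).trans ?_
  rw [← Finset.mul_sum]
  refine mul_le_mul_of_nonneg_left ?_ (sq_nonneg _)
  have h2 : ∑ t ∈ Finset.Ico (p + 1) b, ((t - p : ℕ) : ℝ)⁻¹ =
      ((harmonic (b - (p + 1)) : ℚ) : ℝ) := by
    unfold harmonic
    rw [Finset.sum_Ico_eq_sum_range]
    push_cast
    refine Finset.sum_congr rfl fun u _ => ?_
    rw [show p + 1 + u - p = u + 1 by omega]
    push_cast; rfl
  rw [h2]
  refine (harmonic_le_one_add_log _).trans ?_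
  rcases Nat.eq_zero_or_pos (b - (p + 1)) with h | h
  -- A bin of one round has an empty sum; here `Real.log 0 = 0`.
  · rw [h, Nat.cast_zero, Real.log_zero]
    have : 0 ≤ Real.log n := Real.log_natCast_nonneg n
    linarith
  · have : Real.log ((b - (p + 1) : ℕ) : ℝ) ≤ Real.log n :=
      Real.log_le_log (by exact_mod_cast h) (by norm_cast; omega)
    linarith

theorem binError_le {n : ℕ} {σ lam : ℝ} (hσlam : σ ≤ lam) (hlam : 0 ≤ lam) {θ z : ℕ → ℝ}
    (hz : NoiseBound n lam z) {p b : ℕ} (hpb : p < b) (hbn : b ≤ n)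
    (h : ∀ t, p + 1 ≤ t → t < b → ¬ Restart σ lam (fun s => θ s + z s) (p + 1) t) :
    binError θ (fun s => θ s + z s) p b ≤ lam ^ 2 * (1 + Real.log n) +
      6 * ∑ t ∈ Finset.Ico p b, (θ (t + 1) - θ t) ^ 2 +
      96 * (1 + Real.log n) * rate lam θ (p + 1) b := by
  have hlog : 0 ≤ Real.log n := Real.log_natCast_nonneg n
  have hzp : z p ^ 2 ≤ (lam / 2) ^ 2 := by
    rcases Nat.eq_zero_or_pos p with h0 | h0
    · rw [h0, hz.zero, zero_pow two_ne_zero]; positivity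
    · simpa using hz.sum p p h0 le_rfl (by omega)
  have hfirst : (θ p + z p - θ (p + 1)) ^ 2 ≤ 2 * (lam / 2) ^ 2 + 2 * (θ (p + 1) - θ p) ^ 2 := by
    nlinarith [sq_nonneg (z p + (θ (p + 1) - θ p))]
  have hsum : ∑ t ∈ Finset.Ico (p + 1) b,
      (mean (fun s => θ s + z s) (p + 1) t - θ (t + 1)) ^ 2 ≤
      2 * ((lam / 2) ^ 2 * (1 + Real.log n)) +
      2 * ∑ t ∈ Finset.Ico (p + 1) b, (mean θ (p + 1) t - θ (t + 1)) ^ 2 := by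
    refine le_trans ?_ (add_le_add_left (mul_le_mul_of_nonneg_left
      (sum_sq_mean_noise_le hz hpb hbn) zero_le_two) _)
    rw [Finset.mul_sum, Finset.mul_sum, ← Finset.sum_add_distrib]
    refine Finset.sum_le_sum fun t _ => ?_
    rw [mean_add]
    nlinarith [sq_nonneg (mean z (p + 1) t - (mean θ (p + 1) t - θ (t + 1)))]
  have hsplit : ∑ t ∈ Finset.Ico p b, (θ (t + 1) - θ t) ^ 2 =
      (θ (p + 1) - θ p) ^ 2 + ∑ t ∈ Finset.Ico (p + 1) b, (θ (t + 1) - θ t) ^ 2 :=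
    Finset.sum_eq_sum_Ico_succ_bot hpb _
  have hmain : ∑ t ∈ Finset.Ico (p + 1) b, (mean θ (p + 1) t - θ (t + 1)) ^ 2 ≤
      48 * (1 + Real.log n) * rate lam θ (p + 1) b +
      2 * ∑ t ∈ Finset.Ico (p + 1) b, (θ (t + 1) - θ t) ^ 2 := by
    have hr := rate_nonneg lam θ (p + 1) b
    rcases Nat.lt_or_ge (p + 1) b with h1 | h1
    -- The test may fire after the last round `b`, so the scatter is bounded only up to `c = b - 1`
    -- and the last jump is charged separately.
    · obtain ⟨c, rfl⟩ : ∃ c, b = c + 1 := ⟨b - 1, by omega⟩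
      have hpc : p + 1 ≤ c := by omega
      refine (sum_sq_mean_sub_le' θ hpc).trans ?_
      have hS := scatter_le_of_not_restart hσlam hlam hpc
        (hz.coeff (p + 1) c (by omega) hpc (by omega)) (h c hpc (by omega))
      have hm := padExp_le (n := n) (by omega : 1 ≤ p + 1) hpc (by omega)
      have hmono := rate_mono_right lam θ (a := p + 1) (Nat.le_succ c)
      have hr' := rate_nonneg lam θ (p + 1) c
      have hS' : scatter θ (p + 1) c ≤
          2 * (1 + Real.log n) * (6 * rate lam θ (p + 1) (c + 1)) := by
        refine hS.trans (mul_le_mul hm (by linarith) (by positivity) (by positivity))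
      have hlast := Finset.single_le_sum (f := fun t => (θ (t + 1) - θ t) ^ 2)
        (fun _ _ => sq_nonneg _) (Finset.mem_Ico.mpr ⟨hpc, Nat.lt_succ_self c⟩)
      linarith
    · rw [Finset.Ico_eq_empty (by omega), Finset.sum_empty, Finset.sum_empty]
      positivity
  have hD : 0 ≤ ∑ t ∈ Finset.Ico (p + 1) b, (θ (t + 1) - θ t) ^ 2 :=
    Finset.sum_nonneg fun _ _ => sq_nonneg _
  have hl2 : 0 ≤ lam ^ 2 * Real.log n := by positivity
  have hl3 := sq_nonneg lam
  have hD1 := sq_nonneg (θ (p + 1) - θ p)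
  unfold binError
  rw [hsplit]
  linarith

/-- The bin that is current after round `t`, and the error in the bins before it. -/
theorem exists_bin {n : ℕ} {σ lam : ℝ} (hσ : 0 ≤ σ) (hσlam : σ ≤ lam) {θ z : ℕ → ℝ}
    (hz : NoiseBound n lam z) (y : ℕ → ℝ) (hy : y = fun s => θ s + z s) (t : ℕ) (ht : t ≤ n) :
    ∃ p ≤ t, (∀ s, p ≤ s → s ≤ t → binStart σ lam y s = p + 1) ∧
      (∀ s, p + 1 ≤ s → s ≤ t → ¬ Restart σ lam y (p + 1) s) ∧
      ∑ s ∈ Finset.range p, (predict σ lam y s - θ (s + 1)) ^ 2 ≤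
        6 * ∑ s ∈ Finset.range p, (θ (s + 1) - θ s) ^ 2 +
        98 * (1 + Real.log n) * rate lam θ 1 p := by
  have hlam := hσ.trans hσlam
  have hlog : 0 ≤ Real.log n := Real.log_natCast_nonneg n
  induction t with
  | zero =>
    refine ⟨0, le_rfl, fun s _ hs => ?_, fun s h1 h2 => by omega, ?_⟩
    · rw [Nat.le_zero.mp hs]; rfl
    · have := rate_nonneg lam θ 1 0
      simp only [Finset.range_zero, Finset.sum_empty]
      positivity
  | succ t ih =>
    obtain ⟨p, hpt, hstart, hno, hE⟩ := ih (by omega)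
    by_cases hR : Restart σ lam y (p + 1) (t + 1)
    · refine ⟨t + 1, le_rfl, fun s h1 h2 => ?_, fun s h1 h2 => by omega, ?_⟩
      · rw [le_antisymm h2 h1, binStart, hstart t hpt le_rfl, if_pos hR]
      · have hbin : ∑ s ∈ Finset.Ico p (t + 1), (predict σ lam y s - θ (s + 1)) ^ 2 =
            binError θ y p (t + 1) := by
          rw [Finset.sum_eq_sum_Ico_succ_bot (by omega), binError]
          congr 1
          · rw [predict, if_pos (hstart p le_rfl hpt)]
          · refine Finset.sum_congr rfl fun s hs => ?_
            rw [Finset.mem_Ico] at hs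
            rw [predict, hstart s (by omega) (by omega), if_neg (by omega)]
        have hb := binError_le (θ := θ) hσlam hlam hz (by omega : p < t + 1) ht
          (fun s h1 h2 => by rw [← hy]; exact hno s h1 (by omega))
        rw [← hy] at hb
        -- The closing bin costs `lam ^ 2 * (1 + log n)` besides its 96-fold rate term; the restart
        -- converts this into two more rates, hence 98.
        have hpay := sq_le_rate_of_restart (θ := θ) (z := z) hσ hlam (by omega : p + 1 ≤ t + 1)
          (hz.coeff (p + 1) (t + 1) (by omega) (by omega) ht) (by rw [← hy]; exact hR)
        have hadd := rate_add_rate_le lam θ (by omega : p ≤ t + 1)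
        rw [← Finset.sum_range_add_sum_Ico _ (by omega : p ≤ t + 1),
          ← Finset.sum_range_add_sum_Ico (fun s => (θ (s + 1) - θ s) ^ 2)
            (by omega : p ≤ t + 1), hbin]
        have h1 := mul_le_mul_of_nonneg_right hpay (by positivity : 0 ≤ 1 + Real.log n)
        have h2 := mul_le_mul_of_nonneg_left hadd
          (by positivity : 0 ≤ 98 * (1 + Real.log n))
        linarith
    · refine ⟨p, by omega, fun s h1 h2 => ?_, fun s h1 h2 => ?_, hE⟩
      · rcases Nat.lt_or_ge t s with h3 | h3
        · rw [show s = t + 1 by omega, binStart, hstart t hpt le_rfl, if_neg hR]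
        · exact hstart s h1 h3
      · rcases Nat.lt_or_ge t s with h3 | h3
        · rwa [show s = t + 1 by omega]
        · exact hno s h1 h3

/-- The deterministic error bound for the policy under a bound on the noise. -/
theorem sum_sq_predict_sub_le {n : ℕ} {σ lam : ℝ} (hσ : 0 ≤ σ) (hσlam : σ ≤ lam) {θ z : ℕ → ℝ}
    (hz : NoiseBound n lam z) :
    ∑ s ∈ Finset.range n, (predict σ lam (fun s => θ s + z s) s - θ (s + 1)) ^ 2 ≤
      lam ^ 2 * (1 + Real.log n) + 6 * ∑ s ∈ Finset.range n, (θ (s + 1) - θ s) ^ 2 +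
        98 * (1 + Real.log n) * rate lam θ 1 n := by
  have hlam := hσ.trans hσlam
  have hlog : 0 ≤ Real.log n := Real.log_natCast_nonneg n
  obtain ⟨p, hpn, hstart, hno, hE⟩ := exists_bin (θ := θ) hσ hσlam hz _ rfl n le_rfl
  rcases Nat.lt_or_ge p n with hlt | hge
  -- The last bin has not restarted, so its lam² term stays in the bound.
  · have hb := binError_le (θ := θ) hσlam hlam hz hlt le_rfl
      (fun s h1 h2 => hno s h1 h2.le)
    have hbin : ∑ s ∈ Finset.Ico p n,
        (predict σ lam (fun s => θ s + z s) s - θ (s + 1)) ^ 2 =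
        binError θ (fun s => θ s + z s) p n := by
      rw [Finset.sum_eq_sum_Ico_succ_bot hlt, binError]
      congr 1
      · rw [predict, if_pos (hstart p le_rfl hpn)]
      · refine Finset.sum_congr rfl fun s hs => ?_
        rw [Finset.mem_Ico] at hs
        rw [predict, hstart s (by omega) (by omega), if_neg (by omega)]
    have hadd := rate_add_rate_le lam θ hpn
    rw [← Finset.sum_range_add_sum_Ico _ hpn,
      ← Finset.sum_range_add_sum_Ico (fun s => (θ (s + 1) - θ s) ^ 2) hpn, hbin]
    have h2 := mul_le_mul_of_nonneg_left hadd (by positivity : 0 ≤ 98 * (1 + Real.log n))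
    have h3 : 0 ≤ (1 + Real.log n) * rate lam θ (p + 1) n :=
      mul_nonneg (by positivity) (rate_nonneg _ _ _ _)
    linarith
  · obtain rfl : p = n := le_antisymm hpn hge
    have : 0 ≤ lam ^ 2 * (1 + Real.log p) := by positivity
    linarith

/-! ### Dependence on the past only -/

theorem mean_congr {y y' : ℕ → ℝ} {t : ℕ} (h : ∀ s ≤ t, y s = y' s) (a : ℕ) :
    mean y a t = mean y' a t := by
  unfold mean
  rw [Finset.sum_congr rfl fun s hs => h s (Finset.mem_Icc.mp hs).2]

theorem restart_congr (σ lam : ℝ) {y y' : ℕ → ℝ} {t : ℕ} (h : ∀ s ≤ t, y s = y' s) (a : ℕ) :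
    Restart σ lam y a t ↔ Restart σ lam y' a t := by
  have hp : pad y a t = pad y' a t := by
    funext j
    unfold pad
    split_ifs with hj
    · rw [h _ hj, mean_congr h]
    · rfl
  have hc : thresholdedCoeffs lam y a t = thresholdedCoeffs lam y' a t := by
    funext j
    rw [thresholdedCoeffs, thresholdedCoeffs, hp]
  rw [Restart, Restart, hc]

theorem binStart_congr (σ lam : ℝ) {y y' : ℕ → ℝ} (t : ℕ) (h : ∀ s ≤ t, y s = y' s) :
    binStart σ lam y t = binStart σ lam y' t := by
  induction t with
  | zero => rfl
  | succ t ih =>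
    have ih' := ih fun s hs => h s (by omega)
    rw [binStart, binStart, ih']
    have hR := restart_congr σ lam h (binStart σ lam y' t)
    by_cases hc : Restart σ lam y (binStart σ lam y' t) (t + 1)
    · rw [if_pos hc, if_pos (hR.mp hc)]
    · rw [if_neg hc, if_neg (mt hR.mpr hc)]

theorem predict_congr (σ lam : ℝ) {y y' : ℕ → ℝ} (t : ℕ) (h : ∀ s ≤ t, y s = y' s) :
    predict σ lam y t = predict σ lam y' t := by
  unfold predict
  rw [binStart_congr σ lam t h, h t le_rfl, mean_congr h]

theorem extendZero_add {n : ℕ} (θ z : Fin n → ℝ) (s : ℕ) :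
    extendZero (fun t => θ t + z t) s = extendZero θ s + extendZero z s := by
  unfold extendZero; split_ifs <;> simp

theorem extendZero_smul {n : ℕ} (r : ℝ) (z : Fin n → ℝ) (s : ℕ) :
    extendZero (r • z) s = r * extendZero z s := by
  unfold extendZero; split_ifs <;> simp

theorem extendZero_succ {n : ℕ} (z : Fin n → ℝ) (t : Fin n) :
    extendZero z (t + 1) = z t := by
  unfold extendZero
  rw [dif_pos ⟨by omega, by omega⟩]
  rfl

theorem extendZero_zero {n : ℕ} (z : Fin n → ℝ) : extendZero z 0 = 0 := by
  unfold extendZero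
  rw [dif_neg (by omega)]

/-- In each round the policy sees a different zero-extended truncation of the data. As round `t + 1`
reads only indices up to `t`, all truncations can be replaced by one full sequence. -/
theorem cumulativeError_policy {n : ℕ} (σ β : ℝ) (θ z : Fin n → ℝ) :
    cumulativeError (policy n σ β) θ (fun t => θ t + z t) =
      ∑ s ∈ Finset.range n, (predict σ (σ * √(β * Real.log n))
        (fun s => extendZero θ s + extendZero z s) s - extendZero θ (s + 1)) ^ 2 := by
  unfold cumulativeError policy
  rw [Finset.sum_range]
  refine Finset.sum_congr rfl fun t _ => ?_
  rw [extendZero_succ]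
  congr 2
  apply predict_congr
  intro s hs
  rw [← extendZero_add]
  unfold extendZero
  have := t.isLt
  by_cases h : 1 ≤ s
  · rw [dif_pos ⟨h, hs⟩, dif_pos ⟨h, by omega⟩]
  · rw [dif_neg (by omega), dif_neg (by omega)]

/-! ### Noise functionals of norm at most one -/

theorem sum_sq_extendZero_le {n : ℕ} (z : Fin n → ℝ) {a t : ℕ} (ha : 1 ≤ a) (ht : t ≤ n) :
    ∑ s ∈ Finset.Icc a t, extendZero z s ^ 2 ≤ ∑ i, z i ^ 2 := by
  have h1 : ∑ i, z i ^ 2 = ∑ s ∈ Finset.Ico 1 (n + 1), extendZero z s ^ 2 := by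
    rw [Finset.sum_Ico_eq_sum_range, Nat.add_sub_cancel, Finset.sum_range]
    refine Finset.sum_congr rfl fun i _ => ?_
    rw [add_comm 1, extendZero_succ]
  rw [h1]
  refine Finset.sum_le_sum_of_subset_of_nonneg ?_ fun _ _ _ => sq_nonneg _
  intro s; simp only [Finset.mem_Icc, Finset.mem_Ico]; omega

theorem segCoeff_const_mul (r : ℝ) (z : ℕ → ℝ) (a t j : ℕ) :
    segCoeff (fun s => r * z s) a t j = r * segCoeff z a t j := by
  unfold segCoeff haarCoeff
  rw [Finset.mul_sum]
  refine Finset.sum_congr rfl fun s _ => ?_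
  have hm : mean (fun s => r * z s) a t = r * mean z a t := by
    unfold mean; rw [← Finset.mul_sum, mul_div_assoc]
  unfold padSeq
  rw [hm]
  split_ifs <;> ring

/-- A Haar coefficient of a segment as a linear functional of the whole sequence. -/
def coeffFunctional (n a t j : ℕ) : (Fin n → ℝ) →ₗ[ℝ] ℝ where
  toFun z := segCoeff (extendZero z) a t j
  map_add' z w := by
    rw [← segCoeff_add]
    congr 1
    funext s
    exact extendZero_add z w s
  map_smul' r z := by
    rw [RingHom.id_apply, smul_eq_mul, ← segCoeff_const_mul]
    congr 1
    funext s
    exact extendZero_smul r z s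

/-- The normalized sum over a segment as a linear functional of the whole sequence. -/
def sumFunctional (n a t : ℕ) : (Fin n → ℝ) →ₗ[ℝ] ℝ where
  toFun z := (∑ s ∈ Finset.Icc a t, extendZero z s) / √((t + 1 - a : ℕ) : ℝ)
  map_add' z w := by
    rw [← add_div, ← Finset.sum_add_distrib]
    congr 1
    exact Finset.sum_congr rfl fun s _ => extendZero_add z w s
  map_smul' r z := by
    rw [RingHom.id_apply, smul_eq_mul, ← mul_div_assoc, Finset.mul_sum]
    congr 1
    exact Finset.sum_congr rfl fun s _ => extendZero_smul r z s

/-- By Parseval a squared coefficient is at most the scatter, and recentring does not increase the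
sum of squares. -/
theorem sq_coeffFunctional_le {n a t l i : ℕ} (ha : 1 ≤ a) (hat : a ≤ t) (ht : t ≤ n)
    (hl : l < padExp a t) (hi : i < 2 ^ l) (z : Fin n → ℝ) :
    coeffFunctional n a t (2 ^ l + i) z ^ 2 ≤ ∑ s, z s ^ 2 := by
  refine le_trans ?_ (sum_sq_extendZero_le z ha ht)
  refine le_trans ?_ (scatter_le_sum_sq _ hat)
  rw [← sum_segCoeff_sq _ hat]
  refine le_trans ?_ (Finset.single_le_sum
    (f := fun l => ∑ i ∈ Finset.range (2 ^ l), segCoeff (extendZero z) a t (2 ^ l + i) ^ 2)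
    (fun _ _ => Finset.sum_nonneg fun _ _ => sq_nonneg _) (Finset.mem_range.mpr hl))
  exact Finset.single_le_sum (f := fun i => segCoeff (extendZero z) a t (2 ^ l + i) ^ 2)
    (fun _ _ => sq_nonneg _) (Finset.mem_range.mpr hi)

theorem sq_sumFunctional_le {n a t : ℕ} (ha : 1 ≤ a) (hat : a ≤ t) (ht : t ≤ n)
    (z : Fin n → ℝ) : sumFunctional n a t z ^ 2 ≤ ∑ s, z s ^ 2 := by
  refine le_trans ?_ (sum_sq_extendZero_le z ha ht)
  have hL : (0 : ℝ) < ((t + 1 - a : ℕ) : ℝ) := by norm_cast; omega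
  change ((∑ s ∈ Finset.Icc a t, extendZero z s) / √((t + 1 - a : ℕ) : ℝ)) ^ 2 ≤ _
  rw [div_pow, Real.sq_sqrt hL.le, div_le_iff₀ hL, mul_comm]
  have := sq_sum_le_card_mul_sum_sq (s := Finset.Icc a t) (f := extendZero z)
  rwa [Nat.card_Icc] at this

/-! ### Subgaussian tails and the union bound -/

variable {Ω : Type*} [MeasurableSpace Ω] {P : Measure Ω}

theorem hasSubgaussianMGF_mono {X : Ω → ℝ} {c d : ℝ≥0} (h : HasSubgaussianMGF X c P)
    (hcd : c ≤ d) : HasSubgaussianMGF X d P :=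
  ⟨h.integrable_exp_mul, fun t => (h.mgf_le t).trans <| by
    have : (c : ℝ) ≤ d := hcd
    gcongr⟩

/-- A linear functional of norm at most one of independent `σ`-subgaussian variables is
`σ`-subgaussian. -/
theorem hasSubgaussianMGF_linear {n : ℕ} {σ : ℝ≥0} {Z : Fin n → Ω → ℝ} (hind : iIndepFun Z P)
    (hsub : ∀ t, HasSubgaussianMGF (Z t) (σ ^ 2) P) (f : (Fin n → ℝ) →ₗ[ℝ] ℝ)
    (hf : ∀ z, f z ^ 2 ≤ ∑ s, z s ^ 2) :
    HasSubgaussianMGF (fun ω => f fun t => Z t ω) (σ ^ 2) P := by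
  set w : Fin n → ℝ := fun s => f (Pi.single s 1) with hw
  have hfw : ∀ z, f z = ∑ s, w s * z s := by
    intro z
    conv_lhs => rw [LinearMap.pi_apply_eq_sum_univ f z]
    refine Finset.sum_congr rfl fun s _ => ?_
    rw [smul_eq_mul, mul_comm, hw]
    congr 2
    funext j
    simp [Pi.single_apply, eq_comm]
  -- Testing `f` on its own weight vector gives ‖w‖⁴ ≤ ‖w‖².
  have hw1 : ∑ s, w s ^ 2 ≤ 1 := by
    have h1 := hf w
    have h2 : f w = ∑ s, w s ^ 2 := by
      rw [hfw]; exact Finset.sum_congr rfl fun s _ => (sq _).symm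
    rw [h2] at h1
    nlinarith [Finset.sum_nonneg (s := Finset.univ) fun s _ => sq_nonneg (w s)]
  have hind' : iIndepFun (fun s ω => w s * Z s ω) P :=
    hind.comp (fun s x => w s * x) fun s => measurable_const_mul _
  have h := HasSubgaussianMGF.sum_of_iIndepFun hind' (s := Finset.univ)
    (fun s _ => (hsub s).const_mul (w s))
  have h' : (fun ω => f fun t => Z t ω) = fun ω => ∑ s, w s * Z s ω := by
    funext ω; exact hfw _
  rw [h']
  refine hasSubgaussianMGF_mono h ?_
  have hsum : ((∑ s, NNReal.mk (w s ^ 2) (sq_nonneg _) * σ ^ 2 : ℝ≥0) : ℝ) =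
      (∑ s, w s ^ 2) * (σ : ℝ) ^ 2 := by
    rw [Finset.sum_mul]; push_cast; rfl
  rw [← NNReal.coe_le_coe]
  refine hsum.le.trans ?_
  push_cast
  exact mul_le_of_le_one_left (sq_nonneg _) hw1

theorem measureReal_lt_abs_le [IsProbabilityMeasure P] {X : Ω → ℝ} {σ : ℝ≥0}
    (h : HasSubgaussianMGF X (σ ^ 2) P) {r : ℝ} (hr : 0 ≤ r) :
    P.real {ω | (σ : ℝ) * r < |X ω|} ≤ 2 * Real.exp (-r ^ 2 / 2) := by
  -- The Chernoff exponent degenerates for `σ = 0`; there X vanishes almost surely and the strict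
  -- inequality makes the event null.
  rcases eq_or_ne σ 0 with h0 | h0
  · subst h0
    rw [zero_pow two_ne_zero] at h
    have h1 := h.ae_eq_zero_of_hasSubgaussianMGF_zero
    have h2 : P.real {ω | ((0 : ℝ≥0) : ℝ) * r < |X ω|} = 0 := by
      rw [measureReal_eq_zero_iff]
      refine measure_mono_null ?_ (ae_iff.mp h1)
      intro ω hω hX
      rw [Set.mem_ofPred_eq, hX] at hω
      simp at hω
    rw [h2]; positivity
  · have hσ : (0 : ℝ) < σ := by positivity
    have e : -((σ : ℝ) * r) ^ 2 / (2 * ((σ ^ 2 : ℝ≥0) : ℝ)) = -r ^ 2 / 2 := by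
      push_cast; field_simp
    have h1 := h.measure_ge_le (mul_nonneg hσ.le hr)
    have h2 := h.neg.measure_ge_le (mul_nonneg hσ.le hr)
    rw [e] at h1 h2
    calc P.real {ω | (σ : ℝ) * r < |X ω|}
        ≤ P.real ({ω | (σ : ℝ) * r ≤ X ω} ∪ {ω | (σ : ℝ) * r ≤ (-X) ω}) := by
          refine measureReal_mono ?_
          intro ω hω
          have hω' : (σ : ℝ) * r < |X ω| := hω
          rcases lt_abs.mp hω' with h | h
          · exact Or.inl h.le
          · exact Or.inr h.le
      _ ≤ _ := measureReal_union_le _ _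
      _ ≤ _ := by linarith

/-- The noise bounds hold outside a union of at most `2 * n ^ 3` large-deviation events. -/
theorem exists_measureReal_le_noiseBound [IsProbabilityMeasure P] {n : ℕ} {σ : ℝ≥0}
    {Z : Fin n → Ω → ℝ} (hind : iIndepFun Z P)
    (hsub : ∀ t, HasSubgaussianMGF (Z t) (σ ^ 2) P) {r : ℝ} (hr : 0 ≤ r) :
    ∃ B : Set Ω, P.real B ≤ 2 * (n : ℝ) ^ 3 * (2 * Real.exp (-r ^ 2 / 2)) ∧
      ∀ ω ∉ B, NoiseBound n (2 * (σ * r)) (extendZero fun t => Z t ω) := by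
  -- The index 0 of the constant Haar row is not needed for coefficients, so it encodes the segment
  -- sum. The range `2 * n` suffices since padding at most doubles a length.
  set f : ℕ × ℕ × ℕ → (Fin n → ℝ) →ₗ[ℝ] ℝ := fun q =>
    if q.2.2 = 0 then sumFunctional n q.1 q.2.1 else coeffFunctional n q.1 q.2.1 q.2.2 with hf
  set I : Finset (ℕ × ℕ × ℕ) :=
    (Finset.Icc 1 n ×ˢ Finset.Icc 1 n ×ˢ Finset.range (2 * n)).filter
      fun q => q.1 ≤ q.2.1 ∧ q.2.2 < 2 ^ padExp q.1 q.2.1 with hI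
  refine ⟨⋃ q ∈ I, {ω | (σ : ℝ) * r < |f q fun t => Z t ω|}, ?_, ?_⟩
  · refine (measureReal_biUnion_finset_le _ _).trans ?_
    refine (Finset.sum_le_card_nsmul _ _ (2 * Real.exp (-r ^ 2 / 2)) ?_).trans ?_
    · rintro ⟨a, t, j⟩ hq
      simp only [hI, Finset.mem_filter, Finset.mem_product, Finset.mem_Icc, Finset.mem_range] at hq
      obtain ⟨⟨⟨ha, -⟩, ⟨-, ht⟩, -⟩, hat, hj⟩ := hq
      refine measureReal_lt_abs_le (hasSubgaussianMGF_linear hind hsub _ ?_) hr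
      by_cases hj0 : j = 0
      · simp only [hf, hj0, if_true]
        exact sq_sumFunctional_le ha hat ht
      · simp only [hf, hj0, if_false]
        have hlog : Nat.log 2 j < padExp a t := Nat.log_lt_of_lt_pow hj0 hj
        have h1 := Nat.pow_log_le_self 2 hj0
        have h2 := Nat.lt_pow_succ_log_self one_lt_two j
        rw [pow_succ] at h2
        have := fun z => sq_coeffFunctional_le ha hat ht hlog
          (by omega : j - 2 ^ Nat.log 2 j < 2 ^ Nat.log 2 j) z
        rwa [Nat.add_sub_cancel' h1] at this
    · rw [nsmul_eq_mul]
      refine mul_le_mul_of_nonneg_right ?_ (by positivity)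
      have : I.card ≤ n * (n * (2 * n)) := by
        refine (Finset.card_filter_le _ _).trans (le_of_eq ?_)
        simp
      calc (I.card : ℝ) ≤ ((n * (n * (2 * n)) : ℕ) : ℝ) := by exact_mod_cast this
        _ = _ := by push_cast; ring
  · intro ω hω
    have hω' : ∀ a t j, 1 ≤ a → a ≤ t → t ≤ n → j < 2 ^ padExp a t →
        |f (a, t, j) fun t => Z t ω| ≤ σ * r := by
      intro a t j ha hat ht hj
      by_contra hcon
      refine hω (Set.mem_biUnion (x := (a, t, j)) ?_ (not_le.mp hcon))
      have := two_pow_padExp_le hat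
      simp only [hI, Finset.coe_filter, Set.mem_ofPred_eq, Finset.mem_product, Finset.mem_Icc,
        Finset.mem_range]
      refine ⟨⟨⟨ha, by omega⟩, ⟨by omega, ht⟩, by omega⟩, hat, hj⟩
    refine ⟨extendZero_zero _, ?_, ?_⟩
    · intro a t ha hat ht l hl i hi
      have hpos : 0 < 2 ^ l := by positivity
      have hle : 2 ^ (l + 1) ≤ 2 ^ padExp a t := Nat.pow_le_pow_right two_pos hl
      rw [pow_succ] at hle
      have h := hω' a t (2 ^ l + i) ha hat ht (by omega)
      simp only [hf, show 2 ^ l + i ≠ 0 by omega, if_false] at h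
      refine le_trans h (le_of_eq (by ring))
    · intro a t ha hat ht
      have h := hω' a t 0 ha hat ht (by positivity)
      simp only [hf, if_true] at h
      have hL : (0 : ℝ) < ((t + 1 - a : ℕ) : ℝ) := by norm_cast; omega
      have h2 := pow_le_pow_left₀ (abs_nonneg _) h 2
      rw [sq_abs] at h2
      change ((∑ s ∈ Finset.Icc a t, extendZero (fun t => Z t ω) s) /
        √((t + 1 - a : ℕ) : ℝ)) ^ 2 ≤ _ at h2
      rw [div_pow, Real.sq_sqrt hL.le, div_le_iff₀ hL] at h2
      refine h2.trans (le_of_eq (by ring))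

/-! ### Assembling the bound -/

/-- With θ extended by zero at index 0, the opening prediction `y_0 = 0` counts as a jump of size
θ_1, which is the source of the |θ_1|² term. -/
theorem sum_range_sq_extendZero_sub {n : ℕ} (hn : 0 < n) (θ : Fin n → ℝ) :
    ∑ s ∈ Finset.range n, (extendZero θ (s + 1) - extendZero θ s) ^ 2 =
      |θ ⟨0, hn⟩| ^ 2 + ∑ i, diff θ i ^ 2 := by
  obtain ⟨m, rfl⟩ : ∃ m, n = m + 1 := ⟨n - 1, by omega⟩
  rw [Finset.sum_range_succ', add_comm, Finset.sum_range, sq_abs, extendZero_zero, sub_zero]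
  congr 1
  refine Finset.sum_congr rfl fun i _ => ?_
  rw [diff, ← extendZero_succ θ, ← extendZero_succ θ]

theorem variation_extendZero {n : ℕ} (θ : Fin n → ℝ) :
    variation (extendZero θ) 1 n = ∑ i, |diff θ i| := by
  unfold variation
  rw [Finset.sum_Ico_eq_sum_range, Finset.sum_range]
  refine Finset.sum_congr rfl fun i _ => ?_
  rw [diff, ← extendZero_succ θ, ← extendZero_succ θ, add_comm 1]

/-- The threshold contributes B^(2/3), which is at most B because B ≥ 1. -/
theorem rate_extendZero_le {n : ℕ} (θ : Fin n → ℝ) (σ : ℝ≥0) {B : ℝ} (hB : 1 ≤ B) :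
    rate (σ * √B) (extendZero θ) 1 n ≤
      B * ((n : ℝ) ^ (1 / 3 : ℝ) * (∑ i, |diff θ i|) ^ (2 / 3 : ℝ) * (σ : ℝ) ^ (4 / 3 : ℝ)) := by
  have hV : 0 ≤ ∑ i, |diff θ i| := Finset.sum_nonneg fun _ _ => abs_nonneg _
  refine le_of_pow_le_pow_left₀ (n := 3) (by norm_num) (by positivity) ?_
  rw [rate_pow_three, variation_extendZero, Nat.add_sub_cancel, mul_pow, mul_pow, mul_pow, mul_pow,
    show √B ^ 4 = (√B ^ 2) ^ 2 by ring, Real.sq_sqrt (by linarith)]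
  have e1 : ((n : ℝ) ^ (1 / 3 : ℝ)) ^ 3 = n := by
    rw [← Real.rpow_natCast, ← Real.rpow_mul (by positivity)]; norm_num
  have e2 : ((∑ i, |diff θ i|) ^ (2 / 3 : ℝ)) ^ 3 = (∑ i, |diff θ i|) ^ 2 := by
    rw [← Real.rpow_natCast, ← Real.rpow_mul hV, ← Real.rpow_natCast]; norm_num
  have e3 : ((σ : ℝ) ^ (4 / 3 : ℝ)) ^ 3 = (σ : ℝ) ^ 4 := by
    rw [← Real.rpow_natCast, ← Real.rpow_mul (by positivity), ← Real.rpow_natCast]; norm_num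
  rw [e1, e2, e3]
  have h1 : B ^ 2 ≤ B ^ 3 := pow_le_pow_right₀ hB (by norm_num)
  have h2 : 0 ≤ (σ : ℝ) ^ 4 * n * (∑ i, |diff θ i|) ^ 2 := by positivity
  nlinarith [mul_le_mul_of_nonneg_right h1 h2]

end Arrows

end

theorem theorem1 :
    ∃ C : ℝ, 0 < C ∧ ∃ k : ℕ,
      ∀ (n : ℕ) (hn : 2 ≤ n) (δ : ℝ), 0 < δ → δ ≤ 1 →
      ∀ (σ : ℝ≥0) (θ : Fin n → ℝ)
        (Ω : Type*) [MeasurableSpace Ω] (P : Measure Ω) [IsProbabilityMeasure P]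
        (Z : Fin n → Ω → ℝ),
        (∀ t, Measurable (Z t)) →
        iIndepFun Z P →
        (∀ t, HasSubgaussianMGF (Z t) (σ ^ 2) P) →
        ENNReal.ofReal (1 - δ) ≤
          P {ω | Arrows.cumulativeError
                (Arrows.policy n σ (24 + 8 * Real.log (8 / δ) / Real.log n))
                θ (fun t => θ t + Z t ω) ≤
              C * (1 + Real.log n + Real.log (1 / δ)) ^ k *
                ((n : ℝ) ^ (1 / 3 : ℝ) * (∑ i, |Arrows.diff θ i|) ^ (2 / 3 : ℝ)
                    * (σ : ℝ) ^ (4 / 3 : ℝ)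
                  + |θ ⟨0, by omega⟩| ^ 2 + ∑ i, Arrows.diff θ i ^ 2 + (σ : ℝ) ^ 2)} := by
  -- 2352 = 98 · 24, where 24 comes from B ≤ 24Λ; one power of Λ comes from B and one from 1 + log
  -- n.
  refine ⟨2352, by norm_num, 2, ?_⟩
  intro n hn δ hδ0 hδ1 σ θ Ω _ P _ Z _ hind hsub
  have hn0 : (0 : ℝ) < n := by norm_cast; omega
  have hlogn : 0 < Real.log n := Real.log_pos (by norm_cast)
  have hlogδ : 0 ≤ Real.log (1 / δ) := Real.log_nonneg (by rw [le_div_iff₀ hδ0]; linarith)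
  have hlog8 : Real.log 8 = 3 * Real.log 2 := by
    rw [show (8 : ℝ) = 2 ^ 3 by norm_num, Real.log_pow]; norm_num
  have hlog8δ : Real.log (8 / δ) = 3 * Real.log 2 + Real.log (1 / δ) := by
    rw [← hlog8, ← Real.log_mul (by norm_num) (by positivity), mul_one_div]
  set B := (24 + 8 * Real.log (8 / δ) / Real.log n) * Real.log n with hBdef
  have hB : B = 24 * Real.log n + 8 * Real.log (8 / δ) := by rw [hBdef]; field_simp
  have hB1 : 1 ≤ B := by rw [hB, hlog8δ]; linarith [Real.log_two_gt_d9]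
  set Λ := 1 + Real.log n + Real.log (1 / δ) with hΛ
  have hBΛ : B ≤ 24 * Λ := by rw [hB, hlog8δ, hΛ]; linarith [Real.log_two_lt_d9]
  obtain ⟨bad, hbad, hgood⟩ := Arrows.exists_measureReal_le_noiseBound hind hsub
    (by positivity : 0 ≤ √B / 2)
  have hbadδ : P.real bad ≤ δ := by
    refine hbad.trans ?_
    -- With r = √B / 2 the tail exponent is B / 8 = 3 log n + log(8/δ), so the 2n³ events of
    -- probability at most 2 exp(-B/8) total at most δ / 2.
    have hexp : Real.exp (-(√B / 2) ^ 2 / 2) = ((n : ℝ) ^ 3)⁻¹ * (δ / 8) := by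
      rw [div_pow, Real.sq_sqrt (by linarith), hB,
        show -((24 * Real.log n + 8 * Real.log (8 / δ)) / 2 ^ 2) / 2 =
          -((3 : ℕ) * Real.log n) + -Real.log (8 / δ) by push_cast; ring,
        Real.exp_add, ← Real.log_pow, ← Real.log_inv, ← Real.log_inv,
        Real.exp_log (by positivity), Real.exp_log (by positivity), inv_div]
    rw [hexp]
    field_simp
    linarith
  have hcover : ∀ ω ∉ bad, Arrows.cumulativeError
      (Arrows.policy n σ (24 + 8 * Real.log (8 / δ) / Real.log n)) θ (fun t => θ t + Z t ω) ≤
      2352 * Λ ^ 2 * ((n : ℝ) ^ (1 / 3 : ℝ) * (∑ i, |Arrows.diff θ i|) ^ (2 / 3 : ℝ)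
        * (σ : ℝ) ^ (4 / 3 : ℝ) + |θ ⟨0, by omega⟩| ^ 2 + ∑ i, Arrows.diff θ i ^ 2
        + (σ : ℝ) ^ 2) := by
    intro ω hω
    have hz := hgood ω hω
    rw [show 2 * ((σ : ℝ) * (√B / 2)) = σ * √B by ring] at hz
    have hσlam : (σ : ℝ) ≤ σ * √B :=
      le_mul_of_one_le_right σ.coe_nonneg (Real.one_le_sqrt.mpr hB1)
    have h := Arrows.sum_sq_predict_sub_le (θ := Arrows.extendZero θ) σ.coe_nonneg hσlam hz
    rw [Arrows.cumulativeError_policy]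
    refine h.trans ?_
    rw [Arrows.sum_range_sq_extendZero_sub (by omega), mul_pow, Real.sq_sqrt (by linarith)]
    have hrate := Arrows.rate_extendZero_le θ σ hB1
    have hV : 0 ≤ ∑ i, |Arrows.diff θ i| := Finset.sum_nonneg fun _ _ => abs_nonneg _
    have hD : 0 ≤ ∑ i, Arrows.diff θ i ^ 2 := Finset.sum_nonneg fun _ _ => sq_nonneg _
    have hR : 0 ≤ (n : ℝ) ^ (1 / 3 : ℝ) * (∑ i, |Arrows.diff θ i|) ^ (2 / 3 : ℝ)
        * (σ : ℝ) ^ (4 / 3 : ℝ) := by positivity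
    have hQ : 0 ≤ |θ ⟨0, by omega⟩| ^ 2 + ∑ i, Arrows.diff θ i ^ 2 := by positivity
    set R := (n : ℝ) ^ (1 / 3 : ℝ) * (∑ i, |Arrows.diff θ i|) ^ (2 / 3 : ℝ)
        * (σ : ℝ) ^ (4 / 3 : ℝ)
    set Q := |θ ⟨0, by omega⟩| ^ 2 + ∑ i, Arrows.diff θ i ^ 2 with hQdef
    have hℓ : 1 + Real.log n ≤ Λ := by linarith
    have hΛ1 : 1 ≤ Λ := by linarith
    have hBℓ : B * (1 + Real.log n) ≤ 24 * Λ ^ 2 := by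
      calc B * (1 + Real.log n) ≤ 24 * Λ * Λ :=
            mul_le_mul hBΛ hℓ (by linarith) (by linarith)
        _ = _ := by ring
    have h1 : σ ^ 2 * B * (1 + Real.log n) ≤ 24 * Λ ^ 2 * (σ : ℝ) ^ 2 := by
      calc σ ^ 2 * B * (1 + Real.log n) = B * (1 + Real.log n) * (σ : ℝ) ^ 2 := by ring
        _ ≤ _ := mul_le_mul_of_nonneg_right hBℓ (sq_nonneg _)
    have h2 : 98 * (1 + Real.log n) * Arrows.rate (σ * √B) (Arrows.extendZero θ) 1 n ≤
        2352 * Λ ^ 2 * R := by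
      calc _ ≤ 98 * (1 + Real.log n) * (B * R) :=
            mul_le_mul_of_nonneg_left hrate (by linarith)
        _ = 98 * (B * (1 + Real.log n)) * R := by ring
        _ ≤ 98 * (24 * Λ ^ 2) * R := by gcongr
        _ = _ := by ring
    have h3 : Q ≤ Λ ^ 2 * Q := le_mul_of_one_le_left hQ (one_le_pow₀ hΛ1)
    have h4 : 0 ≤ Λ ^ 2 * (σ : ℝ) ^ 2 := by positivity
    rw [add_assoc R, ← hQdef]
    linarith
  have hP : P bad ≤ ENNReal.ofReal δ := by
    rw [← ofReal_measureReal]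
    exact ENNReal.ofReal_le_ofReal hbadδ
  rw [ENNReal.ofReal_sub _ hδ0.le, ENNReal.ofReal_one, tsub_le_iff_right]
  refine le_trans ?_ (add_le_add_right hP _)
  -- Covering the whole space by the good and the bad event needs only subadditivity, not
  -- measurability of either.
  rw [← measure_univ (μ := P)]
  refine (measure_mono fun ω _ => ?_).trans (measure_union_le _ _)
  by_cases hω : ω ∈ bad
  · exact Or.inr hω
  · exact Or.inl (hcover ω hω)
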